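/- Let $V$ be a finite-dimensional complex vector space with a rational structure $V_{\mathbb Q}$, $W$ a finite increasing filtration of $V$ defined over $\mathbb Q$, and $\mathcal S_k$ rational non-degenerate bilinear forms of parity $(-1)^k$ on $Gr^W_k$. Let $\mathfrak g=Lie(G_{\mathbb C})$ be the Lie algebra of all endomorphisms of $V$ that preserve $W$ and induce infinitesimal isometries of the forms $\mathcal S_k$. Let $(F_\infty,M)$ be a mixed Hodge structure on $(V,V_{\mathbb Q})$ with Deligne bigrading $V=\bigoplus_{p,q} I^{p,q}$, and let $N_1,\dots,N_n\in\mathfrak g$ be commuting rational endomorphisms with $N_jF^p_\infty\subseteq F^{p-1}_\infty$ and $N_jM_k\subseteq M_{k-2}$ (for instance, the limiting mixed Hodge structure and the monodromy logarithms of an admissible variation of graded-polarized mixed Hodge structure over $\Delta^{*n}$ with unipotent monodromy, $M$ being the relative weight filtration). Put $$U^p=\bigoplus_q I^{p,q},\qquad \wp_a=\{\alpha\in\mathfrak g \mid \alpha(U^p)\subseteq U^{p+a}\ \ \forall p\},\qquad q_\infty=\bigoplus_{a<0}\wp_a,$$ and write $\alpha_a$ for the $\wp_a$-component of $\alpha\in\bigoplus_b\wp_b$.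 Let $r>0$, $\Delta^n_r=\{s\in\mathbb C^n \mid |s_j|<r\ \ \forall j\}$, $\Delta^{*n}_r=\{s\in\Delta^n_r \mid s_1\cdots s_n\ne0\}$, and $\Omega=\frac1{2\pi i}\sum_j\frac{ds_j}{s_j}\otimes N_j$. A solution is a holomorphic function $\Gamma:\Delta^n_r\to q_\infty$ with $\Gamma(0)=0$ such that $$e^{-ad\,\Gamma}\,\Omega+e^{-\Gamma}\,\partial e^{\Gamma}\in\wp_{-1}\quad\text{on }\Delta^{*n}_r. \qquad (6.10)$$ Then $\Gamma\mapsto\Gamma_{-1}$ is a bijection from the set of solutions onto the set of holomorphic functions $\Gamma_{-1}:\Delta^n_r\to\wp_{-1}$ which satisfy $\Gamma_{-1}(0)=0$ and $\partial X_{-1}\wedge\partial X_{-1}=0$ on $\Delta^{*n}_r$, where $\partial X_{-1}=\Omega+\partial\Gamma_{-1}$. Moreover, for every solution $\Gamma$: (a) The higher components are determined inductively: for each $k\ge2$, $\Gamma_{-k}$ is the unique holomorphic function $\Delta^n_r\to\wp_{-k}$ that vanishes at $0$ and satisfies on $\Delta^{*n}_r$ $$\partial\Gamma_{-k}=-\left(e^{-ad\,G}\,\Omega+e^{-G}\,\partial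 e^{G}\right)_{-k},\qquad G=\Gamma_{-1}+\dots+\Gamma_{-(k-1)}.$$ (b) The connection $d+\partial X_{-1}$ on the product bundle $V\times\Delta^{*n}_r$ is flat, and its monodromy about the loop $\gamma_j(t)=(s_1,\dots,e^{2\pi it}s_j,\dots,s_n)$, $0\le t\le1$, is $T_j=e^{-\Gamma}e^{-N_j}e^{\Gamma}$ (all evaluated at the base point $s\in\Delta^{*n}_r$). -/

import Mathlib

namespace LimitHodge

noncomputable section

section LinearAlgebra

variable {V : Type*} [NormedAddCommGroup V] [NormedSpace ℂ V]

/-- A rational structure on a complex vector space `V`: a rational subspace `VQ` with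
`V = VQ ⊗ ℂ`, together with the induced complex conjugation of `V`, i.e. the (unique) conjugate
linear map that fixes `VQ` pointwise. -/
structure RationalStructure (V : Type*) [NormedAddCommGroup V] [NormedSpace ℂ V]
    [Module ℚ V] where
  VQ : Submodule ℚ V
  isBaseChange : IsBaseChange ℂ VQ.subtype
  conj : V →ₛₗ[starRingEnd ℂ] V
  conj_eq_self : ∀ v ∈ VQ, conj v = v

/-- The complex conjugate of a subspace (conjugation is an involution, so that image and preimage
agree). -/
def RationalStructure.conjSubspace [Module ℚ V] (R : RationalStructure V) (U : Submodule ℂ V) :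
    Submodule ℂ V :=
  U.comap R.conj

/-- A complex subspace is defined over `ℚ` if it is spanned by its rational vectors. -/
def RationalStructure.IsRational [Module ℚ V] (R : RationalStructure V) (U : Submodule ℂ V) :
    Prop :=
  Submodule.span ℂ {v : V | v ∈ U ∧ v ∈ R.VQ} = U

/-- The graded quotient `Gr_k = W_k / W_{k-1}`. -/
abbrev Gr (W : ℤ → Submodule ℂ V) (k : ℤ) : Type _ :=
  ↥(W k) ⧸ (W (k - 1)).submoduleOf (W k)

/-- The class in `Gr_k` of an element of `W_k`. -/
def toGr (W : ℤ → Submodule ℂ V) (k : ℤ) : ↥(W k) →ₗ[ℂ] Gr W k :=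
  ((W (k - 1)).submoduleOf (W k)).mkQ

/-- The endomorphism of `Gr_k` induced by an endomorphism that preserves `W`. -/
def grMap (W : ℤ → Submodule ℂ V) (α : V →L[ℂ] V) (h : ∀ k, ∀ v ∈ W k, α v ∈ W k) (k : ℤ) :
    Gr W k →ₗ[ℂ] Gr W k :=
  Submodule.mapQ _ _ ((α : V →ₗ[ℂ] V).restrict (h k)) (fun x hx => h (k - 1) x.1 hx)

/-- The image of a subspace `U` in `Gr_k`, i.e. `(U ∩ W_k + W_{k-1}) / W_{k-1}`. -/
def inducedGr (W : ℤ → Submodule ℂ V) (U : Submodule ℂ V) (k : ℤ) : Submodule ℂ (Gr W k) :=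
  (U.submoduleOf (W k)).map (toGr W k)

/-- `W` is a finite increasing filtration of `V`. -/
structure IsIncFiltration (W : ℤ → Submodule ℂ V) : Prop where
  mono : Monotone W
  bot : ∃ k, W k = ⊥
  top : ∃ k, W k = ⊤

/-- `F` is a finite decreasing filtration of `V`. -/
structure IsDecFiltration (F : ℤ → Submodule ℂ V) : Prop where
  anti : Antitone F
  bot : ∃ p, F p = ⊥
  top : ∃ p, F p = ⊤

/-- `(F, M)` is a mixed Hodge structure on `V`: the weight filtration `M` is defined over `ℚ`, and
for each `k` the filtration induced by `F` on `Gr^M_k` is a pure Hodge structure of weight `k`,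
that is, `Gr^M_k = F^p Gr ⊕ conj (F^{k+1-p} Gr)` for all `p`.
(As `M` is defined over `ℚ`, the conjugate of the filtration induced by `F` is the filtration
induced by the conjugate of `F`.) -/
structure IsMixedHodgeStructure [Module ℚ V] (R : RationalStructure V)
    (F M : ℤ → Submodule ℂ V) : Prop where
  dec : IsDecFiltration F
  inc : IsIncFiltration M
  rational : ∀ k, R.IsRational (M k)
  pure : ∀ k p : ℤ,
    IsCompl (inducedGr M (F p) k) (inducedGr M (R.conjSubspace (F (k + 1 - p))) k)

/-- The Deligne bigrading `I^{p,q}` of a mixed Hodge structure `(F, M)`, by Deligne's formula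
`I^{p,q} = F^p ∩ M_{p+q} ∩ (conj F^q ∩ M_{p+q} + ∑_{i ≥ 1} conj F^{q-i} ∩ M_{p+q-i-1})`.
It is the unique bigrading `V = ⨁ I^{p,q}` with `F^p = ⨁_{r ≥ p, s} I^{r,s}`,
`M_k = ⨁_{r+s ≤ k} I^{r,s}` and `I^{p,q} = conj I^{q,p}` modulo `⨁_{r<p, s<q} I^{r,s}`. -/
def deligneI [Module ℚ V] (R : RationalStructure V) (F M : ℤ → Submodule ℂ V) (p q : ℤ) :
    Submodule ℂ V :=
  F p ⊓ M (p + q) ⊓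
    ((R.conjSubspace (F q) ⊓ M (p + q)) ⊔
      ⨆ i : ℕ, R.conjSubspace (F (q - (i + 1))) ⊓ M (p + q - (i + 1) - 1))

/-- The subspaces `U^p = ⨁_q I^{p,q}`. -/
def hodgeU [Module ℚ V] (R : RationalStructure V) (F M : ℤ → Submodule ℂ V) (p : ℤ) :
    Submodule ℂ V :=
  ⨆ q, deligneI R F M p q

/-- The Lie algebra of the complex group of all automorphisms of `V` that preserve the filtration
`W` and induce isometries of the bilinear forms `S_k` on `Gr^W_k`: the endomorphisms that preserve
`W` and induce infinitesimal isometries of all the forms `S_k`. -/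
def lieG (W : ℤ → Submodule ℂ V) (S : ∀ k, LinearMap.BilinForm ℂ (Gr W k)) :
    Submodule ℂ (V →L[ℂ] V) where
  carrier := {α | ∃ h : ∀ k, ∀ v ∈ W k, α v ∈ W k,
    ∀ k x y, S k (grMap W α h k x) y + S k x (grMap W α h k y) = 0}
  zero_mem' := by
    refine ⟨fun k v _ => by simp, fun k x y => ?_⟩
    obtain ⟨x, rfl⟩ := Submodule.Quotient.mk_surjective _ x
    obtain ⟨y, rfl⟩ := Submodule.Quotient.mk_surjective _ y
    have e : ∀ (h : ∀ k, ∀ v ∈ W k, (0 : V →L[ℂ] V) v ∈ W k) (z : W k),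
        grMap W 0 h k (Submodule.Quotient.mk z) = 0 := fun h z =>
      (Submodule.Quotient.mk_eq_zero _).2 (Submodule.zero_mem _)
    simp [e]
  add_mem' := by
    rintro α β ⟨ha, hα⟩ ⟨hb, hβ⟩
    refine ⟨fun k v hv => (W k).add_mem (ha k v hv) (hb k v hv), fun k x y => ?_⟩
    have e : ∀ (h : ∀ k, ∀ v ∈ W k, (α + β) v ∈ W k) (z : Gr W k),
        grMap W (α + β) h k z = grMap W α ha k z + grMap W β hb k z := fun h z => by
      obtain ⟨z, rfl⟩ := Submodule.Quotient.mk_surjective _ z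
      rfl
    have h1 := hα k x y
    have h2 := hβ k x y
    simp only [e, map_add, LinearMap.add_apply]
    linear_combination h1 + h2
  smul_mem' := by
    rintro c α ⟨ha, hα⟩
    refine ⟨fun k v hv => (W k).smul_mem c (ha k v hv), fun k x y => ?_⟩
    have e : ∀ (h : ∀ k, ∀ v ∈ W k, (c • α) v ∈ W k) (z : Gr W k),
        grMap W (c • α) h k z = c • grMap W α ha k z := fun h z => by
      obtain ⟨z, rfl⟩ := Submodule.Quotient.mk_surjective _ z
      rfl
    have h1 := hα k x y
    simp only [e, map_smul, LinearMap.smul_apply, smul_eq_mul]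
    linear_combination c * h1

end LinearAlgebra

/-- The linear algebra data at the origin of an admissible variation of graded-polarized mixed
Hodge structure over `Δ*^n`:
* a rational structure on `V`, a weight filtration `W` defined over `ℚ`, and rational,
  non-degenerate bilinear forms `S_k` on `Gr^W_k` of parity `(-1)^k`;
* a mixed Hodge structure `(F, M)` on `V`, the limiting mixed Hodge structure;
* commuting rational endomorphisms `N_1, …, N_n`, the monodromy logarithms, which belong to the
  Lie algebra attached to `(W, S)` and are `(-1,-1)`-morphisms of `(F, M)`.
For an admissible variation, `M` is the relative weight filtration of `W` and the monodromy cone;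
no more than the above is required of it here. -/
structure LimitData (V : Type*) [NormedAddCommGroup V] [NormedSpace ℂ V] [Module ℚ V]
    (n : ℕ) where
  R : RationalStructure V
  W : ℤ → Submodule ℂ V
  W_filtration : IsIncFiltration W
  W_rational : ∀ k, R.IsRational (W k)
  S : ∀ k, LinearMap.BilinForm ℂ (Gr W k)
  S_nondegenerate : ∀ k, (S k).Nondegenerate
  S_parity : ∀ k x y, S k y x = (k.negOnePow : ℤ) • S k x y
  S_rational : ∀ k (x y : W k), (x : V) ∈ R.VQ → (y : V) ∈ R.VQ →
    ∃ c : ℚ, S k (toGr W k x) (toGr W k y) = (c : ℂ)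
  F : ℤ → Submodule ℂ V
  M : ℤ → Submodule ℂ V
  isMixedHodgeStructure : IsMixedHodgeStructure R F M
  N : Fin n → (V →L[ℂ] V)
  N_comm : ∀ i j, N i * N j = N j * N i
  N_mem : ∀ j, N j ∈ lieG W S
  N_rational : ∀ j, ∀ v ∈ R.VQ, N j v ∈ R.VQ
  N_F : ∀ j p, ∀ v ∈ F p, N j v ∈ F (p - 1)
  N_M : ∀ j k, ∀ v ∈ M k, N j v ∈ M (k - 2)

/-- The polydisk of radius `r` in `ℂ^n`. -/
def polydisk (n : ℕ) (r : ℝ) : Set (Fin n → ℂ) := {s | ∀ j, ‖s j‖ < r}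

/-- The complement of the coordinate hyperplanes in the polydisk of radius `r`. -/
def puncturedPolydisk (n : ℕ) (r : ℝ) : Set (Fin n → ℂ) :=
  {s | s ∈ polydisk n r ∧ ∀ j, s j ≠ 0}

/-- Extension by zero of a function on the polydisk. As the polydisk is open, the values of the
extension outside of it play no role in what follows. -/
def ext {n : ℕ} {r : ℝ} {E : Type*} [Zero E] (f : polydisk n r → E) : (Fin n → ℂ) → E :=
  Function.extend Subtype.val f 0

/-- Holomorphic functions on the polydisk. -/
def IsHolomorphic {n : ℕ} {r : ℝ} {E : Type*} [NormedAddCommGroup E] [NormedSpace ℂ E]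
    (f : polydisk n r → E) : Prop :=
  DifferentiableOn ℂ (ext f) (polydisk n r)

/-- The partial derivative `∂f/∂s_j`. -/
def pderiv {n : ℕ} {E : Type*} [NormedAddCommGroup E] [NormedSpace ℂ E]
    (j : Fin n) (f : (Fin n → ℂ) → E) (s : Fin n → ℂ) : E :=
  fderiv ℂ f s (Pi.single j 1)

section Equation

variable {V : Type*} [NormedAddCommGroup V] [NormedSpace ℂ V] [Module ℚ V] {n : ℕ}

/-- `ad x = [x, ·]` as an operator on the endomorphisms of `V`. -/
def adOp (x : V →L[ℂ] V) : (V →L[ℂ] V) →L[ℂ] (V →L[ℂ] V) :=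
  ContinuousLinearMap.mul ℂ (V →L[ℂ] V) x - (ContinuousLinearMap.mul ℂ (V →L[ℂ] V)).flip x

/-- The exponential in a normed ring (`NormedSpace.exp`). -/
def ringExp {A : Type*} [NormedRing A] (x : A) : A := NormedSpace.exp x

/-- `e^{-ad x} y`, where `e^{-ad x}` is the exponential of an operator on the endomorphisms of
`V`. -/
def expNegAd (x y : V →L[ℂ] V) : V →L[ℂ] V := ringExp (-(adOp x)) y

namespace LimitData

variable (D : LimitData V n)

/-- The Lie algebra of the group attached to `(W, S)`. -/
def lieAlg : Submodule ℂ (V →L[ℂ] V) := lieG D.W D.S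

/-- The subspaces `U^p` of the limiting mixed Hodge structure. -/
def U (p : ℤ) : Submodule ℂ V := hodgeU D.R D.F D.M p

/-- `℘_a`: the elements of the Lie algebra that map `U^p` to `U^{p+a}` for all `p`. -/
def wp (a : ℤ) : Submodule ℂ (V →L[ℂ] V) where
  carrier := {α | α ∈ D.lieAlg ∧ ∀ p, ∀ u ∈ D.U p, α u ∈ D.U (p + a)}
  zero_mem' := ⟨Submodule.zero_mem _, fun p u _ => by simp⟩
  add_mem' := fun {α β} hα hβ => ⟨Submodule.add_mem _ hα.1 hβ.1,
    fun p u hu => (D.U (p + a)).add_mem (hα.2 p u hu) (hβ.2 p u hu)⟩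
  smul_mem' := fun c {α} hα => ⟨Submodule.smul_mem _ c hα.1,
    fun p u hu => (D.U (p + a)).smul_mem c (hα.2 p u hu)⟩

/-- The graded nilpotent Lie algebra `q = ⨁_{a<0} ℘_a`. -/
def qInf : Submodule ℂ (V →L[ℂ] V) := ⨆ a : ℤ, ⨆ _ : a < 0, D.wp a

/-- The component `α_a ∈ ℘_a` of an element `α = ∑_b α_b` of `⨁_b ℘_b`. -/
def component (a : ℤ) (α : V →L[ℂ] V) : V →L[ℂ] V :=
  (Classical.epsilon fun β : ℤ →₀ (V →L[ℂ] V) =>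
    (∀ b, β b ∈ D.wp b) ∧ (β.sum fun _ x => x) = α) a

/-- The coefficient of `ds_j` in `Ω = (1 / 2πi) ∑_j (ds_j / s_j) ⊗ N_j`. -/
def omega (j : Fin n) (s : Fin n → ℂ) : V →L[ℂ] V :=
  (1 / (2 * Real.pi * Complex.I) * (1 / s j)) • D.N j

/-- The coefficient of `ds_j` in `e^{-ad Γ} Ω + e^{-Γ} ∂e^Γ`. -/
def form (Γ : (Fin n → ℂ) → (V →L[ℂ] V)) (j : Fin n) (s : Fin n → ℂ) : V →L[ℂ] V :=
  expNegAd (Γ s) (D.omega j s) +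
    NormedSpace.exp (-(Γ s)) * pderiv j (fun u => NormedSpace.exp (Γ u)) s

/-- Solutions of the differential equation: holomorphic functions `Γ` from the polydisk to `q`,
vanishing at the origin, such that `e^{-ad Γ} Ω + e^{-Γ} ∂e^Γ ∈ ℘_{-1}` on the complement of the
coordinate hyperplanes. -/
def IsSolution {r : ℝ} (Γ : polydisk n r → (V →L[ℂ] V)) : Prop :=
  IsHolomorphic Γ ∧ (∀ s, Γ s ∈ D.qInf) ∧ ext Γ 0 = 0 ∧
    ∀ s ∈ puncturedPolydisk n r, ∀ j, D.form (ext Γ) j s ∈ D.wp (-1)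

/-- The coefficient of `ds_j` in `∂X_{-1} = Ω + ∂Γ_{-1}`, where `g = Γ_{-1}`. -/
def higgs {r : ℝ} (g : polydisk n r → (V →L[ℂ] V)) (j : Fin n) (s : Fin n → ℂ) : V →L[ℂ] V :=
  D.omega j s + pderiv j (ext g) s

/-- Holomorphic functions `g = Γ_{-1}` from the polydisk to `℘_{-1}`, vanishing at the origin, with
`∂X_{-1} ∧ ∂X_{-1} = 0` on the complement of the coordinate hyperplanes. -/
def IsHiggsMap {r : ℝ} (g : polydisk n r → (V →L[ℂ] V)) : Prop :=
  IsHolomorphic g ∧ (∀ s, g s ∈ D.wp (-1)) ∧ ext g 0 = 0 ∧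
    ∀ s ∈ puncturedPolydisk n r, ∀ i j,
      D.higgs g i s * D.higgs g j s - D.higgs g j s * D.higgs g i s = 0

/-- The component `Γ_a` of a function `Γ` on the polydisk. -/
def componentMap {r : ℝ} (a : ℤ) (Γ : polydisk n r → (V →L[ℂ] V)) :
    polydisk n r → (V →L[ℂ] V) :=
  fun s => D.component a (Γ s)

/-- The truncation `Γ_{-1} + ⋯ + Γ_{-(k-1)}` of a function `Γ` on the polydisk. -/
def truncation {r : ℝ} (k : ℕ) (Γ : polydisk n r → (V →L[ℂ] V)) :
    polydisk n r → (V →L[ℂ] V) :=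
  fun s => ∑ i ∈ Finset.Ico 1 k, D.component (-(i : ℤ)) (Γ s)

/-- The curvature of the connection `d + ∂X_{-1}` on the trivial bundle with fibre `V` vanishes on
the complement of the coordinate hyperplanes. -/
def IsFlat {r : ℝ} (g : polydisk n r → (V →L[ℂ] V)) : Prop :=
  ∀ s ∈ puncturedPolydisk n r, ∀ i j,
    pderiv i (D.higgs g j) s - pderiv j (D.higgs g i) s
      + (D.higgs g i s * D.higgs g j s - D.higgs g j s * D.higgs g i s) = 0

/-- The loop `γ_j(t) = (s_1, …, e^{2πit} s_j, …, s_n)`, `0 ≤ t ≤ 1`. -/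
def loop (j : Fin n) (s : Fin n → ℂ) (t : ℝ) : Fin n → ℂ :=
  Function.update s j (Complex.exp (2 * Real.pi * Complex.I * t) * s j)

/-- `T` is the monodromy of the connection `d + ∂X_{-1}` along the loop `γ_j` at `s`: parallel
translation of `v` along the loop, i.e. solving `σ' + ∂X_{-1}(γ_j') σ = 0` with `σ(0) = v`, ends at
`σ(1) = T v`. -/
def IsMonodromy {r : ℝ} (g : polydisk n r → (V →L[ℂ] V)) (j : Fin n) (s : Fin n → ℂ)
    (T : V →L[ℂ] V) : Prop :=
  ∀ v : V, ∃ σ : ℝ → V, σ 0 = v ∧ σ 1 = T v ∧ ∀ t ∈ Set.Icc (0 : ℝ) 1,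
    HasDerivWithinAt σ
      (-((2 * Real.pi * Complex.I * loop j s t j) • D.higgs g j (loop j s t) (σ t)))
      (Set.Icc 0 1) t

end LimitData

end Equation

end

end LimitHodge

/-!
Multiplying by `s_j` turns `∂_j` into the Euler derivation `θ_j = s_j ∂_j` and the polar form `Ω`
into the constant residues `R_j = N_j / 2πi`. Since `Γ` takes values in the negative part of a
grading, `∂X_{-1}` is the degree `-1` part of the left-hand side of (6.10), and (6.10) becomes
`θ_j e^Γ + R_j e^Γ = e^Γ (R_j + θ_j Γ_{-1})`: the unipotent map `e^Γ` intertwines the connection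
`d + ∂X_{-1}` with `d + Ω`. Hence the flatness of `d + Ω`, which holds because the `N_j` commute,
transfers to `d + ∂X_{-1}`, and so does the monodromy `e^{-N_j}`. The degree `-k` part of (6.10)
expresses `θ_j Γ_{-k}` through components of lower order, which gives the inductive formula and
uniqueness. Conversely, if `∂X_{-1} ∧ ∂X_{-1} = 0`, the intertwining equation is integrable, and its
unipotent solution `u` is built degree by degree with a logarithmic Poincaré lemma: integrate along
rays from the origin, the nilpotent residues causing no resonance. The logarithm of `u` stays in
`𝔤` because the logarithmic derivative of `u` does.
-/

namespace LimitHodge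

noncomputable section

/-! ### Opposite filtrations and the Deligne bigrading -/

section OppositeFiltrations

variable {R E : Type*} [Ring R] [AddCommGroup E] [Module R E] {F A : ℤ → Submodule R E}

theorem iSupIndep_inf_of_opposite (hF : Antitone F) (hA : Monotone A)
    (hFA : ∀ p, Disjoint (F p) (A p)) : iSupIndep fun p => F p ⊓ A (p + 1) := by
  intro p
  have others_le : (⨆ q, ⨆ (_ : q ≠ p), F q ⊓ A (q + 1)) ≤ F (p + 1) ⊔ A p := by
    refine iSup₂_le fun q hq => ?_
    rcases lt_or_gt_of_ne hq with hq | hq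
    · exact (inf_le_right.trans (hA (by lia))).trans le_sup_right
    · exact (inf_le_left.trans (hF (by lia))).trans le_sup_left
  refine Disjoint.mono_right others_le (Submodule.disjoint_def.2 ?_)
  rintro x ⟨hxF, hxA⟩ hx
  obtain ⟨f, hf, a, ha, rfl⟩ := Submodule.mem_sup.1 hx
  have haF : a ∈ F p := (Submodule.add_mem_iff_right _ (hF (by lia) hf)).1 hxF
  obtain rfl : a = 0 := Submodule.disjoint_def.1 (hFA p) a haF ha
  rw [add_zero] at hxA ⊢
  exact Submodule.disjoint_def.1 (hFA (p + 1)) f hf hxA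

theorem iSup_inf_eq_top_of_opposite (hF : Antitone F) (hFA : ∀ p, Codisjoint (F p) (A p))
    (hbot : ∃ p, F p = ⊥) (htop : ∃ p, F p = ⊤) : ⨆ p, F p ⊓ A (p + 1) = ⊤ := by
  obtain ⟨b, hb⟩ := hbot
  obtain ⟨t, ht⟩ := htop
  have le_iSup_of_le : ∀ q ≤ b, F q ≤ ⨆ p, F p ⊓ A (p + 1) := by
    intro q hq
    induction q, hq using Int.leInductionDown with
    | base => simp [hb]
    | pred q _ ih =>
      intro x hx
      obtain ⟨f, hf, a, ha, rfl⟩ := Submodule.mem_sup.1 <|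
        (hFA q).eq_top ▸ Submodule.mem_top (x := x)
      have haF : a ∈ F (q - 1) := (Submodule.add_mem_iff_right _ (hF (by lia) hf)).1 hx
      exact add_mem (ih hf) (Submodule.mem_iSup_of_mem (q - 1) ⟨haF, by rwa [sub_add_cancel]⟩)
  rw [eq_top_iff, ← ht]
  exact (hF (min_le_left t b)).trans (le_iSup_of_le _ (min_le_right t b))

end OppositeFiltrations

section OppositeFiltration

variable {V : Type*} [NormedAddCommGroup V] [NormedSpace ℂ V] {F G M : ℤ → Submodule ℂ V}
  {b m p : ℤ}

theorem toGr_eq_iff {W : ℤ → Submodule ℂ V} {k : ℤ} {x y : W k} :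
    toGr W k x = toGr W k y ↔ (x : V) - y ∈ W (k - 1) :=
  Submodule.Quotient.eq _

/-- The increasing filtration `p ↦ ∑_{j ≤ m} G^{j+1-p} ∩ M_j` of `M_m`. When `F` and `G` induce
opposite filtrations on every `Gr^M_k`, it is opposite to the filtration of `M_m` induced by `F`. -/
def oppositeFiltration (G M : ℤ → Submodule ℂ V) (m p : ℤ) : Submodule ℂ V :=
  ⨆ j, ⨆ (_ : j ≤ m), G (j + 1 - p) ⊓ M j

theorem oppositeFiltration_le (hM : Monotone M) (m p : ℤ) : oppositeFiltration G M m p ≤ M m :=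
  iSup₂_le fun _ hj => inf_le_right.trans (hM hj)

theorem oppositeFiltration_mono (hG : Antitone G) (m : ℤ) : Monotone (oppositeFiltration G M m) :=
  fun _ _ hp => iSup₂_mono fun _ _ => inf_le_inf_right _ (hG (by lia))

theorem oppositeFiltration_eq_sup (G M : ℤ → Submodule ℂ V) (m p : ℤ) :
    oppositeFiltration G M m p = G (m + 1 - p) ⊓ M m ⊔ oppositeFiltration G M (m - 1) p := by
  refine le_antisymm (iSup₂_le fun j hj => ?_) (sup_le (le_iSup₂_of_le m le_rfl le_rfl) ?_)
  · rcases hj.eq_or_lt with rfl | hj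
    · exact le_sup_left
    · exact le_sup_of_le_right (le_iSup₂_of_le j (by lia) le_rfl)
  · exact iSup₂_le fun j hj => le_iSup₂_of_le j (by lia) le_rfl

theorem oppositeFiltration_eq_bot (hM : Monotone M) (hb : M b = ⊥) (hm : m ≤ b) :
    oppositeFiltration G M m p = ⊥ :=
  le_bot_iff.1 ((oppositeFiltration_le hM m p).trans (hb ▸ hM hm))

theorem le_inf_sup_oppositeFiltration (hM : Monotone M) (hb : M b = ⊥)
    (hFG : ∀ k p, Codisjoint (inducedGr M (F p) k) (inducedGr M (G (k + 1 - p)) k)) :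
    M m ≤ F p ⊓ M m ⊔ oppositeFiltration G M m p := by
  rcases le_total m b with hm | hm
  · exact (hM hm).trans (hb ▸ bot_le)
  induction m, hm using Int.leInduction with
  | base => exact hb ▸ bot_le
  | succ m _ ih =>
    intro x hx
    obtain ⟨_, ⟨f, hf, rfl⟩, _, ⟨g, hg, rfl⟩, hfg⟩ :=
      Submodule.mem_sup.1 ((hFG (m + 1) p).eq_top ▸ Submodule.mem_top (x := toGr M (m + 1) ⟨x, hx⟩))
    rw [← map_add, eq_comm, toGr_eq_iff, add_sub_cancel_right] at hfg
    obtain ⟨f', hf', a, ha, hfa⟩ := Submodule.mem_sup.1 (ih hfg)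
    obtain rfl : x = (f + f') + (g + a) := by
      rw [add_add_add_comm, hfa]
      exact (add_sub_cancel _ x).symm
    rw [oppositeFiltration_eq_sup, add_sub_cancel_right]
    exact Submodule.add_mem_sup
      ⟨add_mem hf hf'.1, add_mem f.2 (hM (by lia) hf'.2)⟩ (Submodule.add_mem_sup ⟨hg, g.2⟩ ha)

theorem disjoint_oppositeFiltration (hG : Antitone G) (hM : Monotone M) (hb : M b = ⊥)
    (hFG : ∀ k p, Disjoint (inducedGr M (F p) k) (inducedGr M (G (k + 1 - p)) k)) :
    Disjoint (F p) (oppositeFiltration G M m p) := by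
  rcases le_total m b with hm | hm
  · exact oppositeFiltration_eq_bot (G := G) hM hb hm ▸ disjoint_bot_right
  induction m, hm using Int.leInduction with
  | base => exact oppositeFiltration_eq_bot (G := G) hM hb le_rfl ▸ disjoint_bot_right
  | succ m _ ih =>
    refine Submodule.disjoint_def.2 fun x hxF hxA => Submodule.disjoint_def.1 ih x hxF ?_
    have hxM := oppositeFiltration_le hM _ _ hxA
    rw [oppositeFiltration_eq_sup, add_sub_cancel_right] at hxA
    obtain ⟨g, hg, a, ha, rfl⟩ := Submodule.mem_sup.1 hxA
    have toGr_eq : toGr M (m + 1) ⟨g + a, hxM⟩ = toGr M (m + 1) ⟨g, hg.2⟩ :=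
      toGr_eq_iff.2 (by simpa using oppositeFiltration_le hM _ _ ha)
    have toGr_eq_zero : toGr M (m + 1) ⟨g, hg.2⟩ = toGr M (m + 1) 0 :=
      (Submodule.disjoint_def.1 (hFG (m + 1) p) _ ⟨_, hxF, toGr_eq⟩ ⟨_, hg.1, rfl⟩).trans
        (map_zero _).symm
    have hgM : g ∈ M m := by simpa using toGr_eq_iff.1 toGr_eq_zero
    exact add_mem (le_iSup₂_of_le (f := fun j (_ : j ≤ m) => G (j + 1 - p) ⊓ M j) m le_rfl le_rfl
      ⟨hG (by lia) hg.1, hgM⟩) ha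

end OppositeFiltration

namespace RationalStructure

variable {V : Type*} [NormedAddCommGroup V] [NormedSpace ℂ V] [Module ℚ V]
  (R : RationalStructure V)

theorem span_VQ : Submodule.span ℂ (R.VQ : Set V) = ⊤ := by
  have mkQ_eq_zero : (Submodule.span ℂ (R.VQ : Set V)).mkQ = 0 :=
    R.isBaseChange.algHom_ext _ _ fun x => by simpa using Submodule.subset_span x.2
  rw [← Submodule.ker_mkQ (Submodule.span ℂ (R.VQ : Set V)), mkQ_eq_zero, LinearMap.ker_zero]

theorem conj_apply_comm (N : V →ₗ[ℂ] V) (hN : ∀ v ∈ R.VQ, N v ∈ R.VQ) (v : V) :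
    R.conj (N v) = N (R.conj v) := by
  have hv : v ∈ Submodule.span ℂ (R.VQ : Set V) := R.span_VQ ▸ Submodule.mem_top
  induction hv using Submodule.span_induction with
  | mem x hx => rw [R.conj_eq_self x hx, R.conj_eq_self _ (hN x hx)]
  | zero => simp only [map_zero]
  | add x y _ _ hx hy => simp only [map_add, hx, hy]
  | smul a x _ hx => simp only [map_smul, LinearMap.map_smulₛₗ, hx]

end RationalStructure

namespace IsMixedHodgeStructure

variable {V : Type*} [NormedAddCommGroup V] [NormedSpace ℂ V] [Module ℚ V]
  {R : RationalStructure V} {F M : ℤ → Submodule ℂ V} {b t : ℤ}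

theorem antitone_conj (h : IsMixedHodgeStructure R F M) :
    Antitone fun q => R.conjSubspace (F q) :=
  fun _ _ hpq => Submodule.comap_mono (h.dec.anti hpq)

theorem le_inf_sup_opposite (h : IsMixedHodgeStructure R F M) (m p : ℤ) :
    M m ≤ F p ⊓ M m ⊔ oppositeFiltration (fun q => R.conjSubspace (F q)) M m p := by
  obtain ⟨b, hb⟩ := h.inc.bot
  exact le_inf_sup_oppositeFiltration (G := fun q => R.conjSubspace (F q)) h.inc.mono hb
    fun k p => (h.pure k p).codisjoint

theorem isCompl_opposite (h : IsMixedHodgeStructure R F M) (ht : M t = ⊤) (p : ℤ) :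
    IsCompl (F p) (oppositeFiltration (fun q => R.conjSubspace (F q)) M t p) := by
  obtain ⟨b, hb⟩ := h.inc.bot
  refine ⟨disjoint_oppositeFiltration h.antitone_conj h.inc.mono hb
    fun k p => (h.pure k p).disjoint, codisjoint_iff_le_sup.2 ?_⟩
  simpa only [ht, inf_top_eq] using h.le_inf_sup_opposite t p

theorem deligneI_le_opposite (h : IsMixedHodgeStructure R F M) (ht : M t = ⊤) (p q : ℤ) :
    deligneI R F M p q ≤ oppositeFiltration (fun q => R.conjSubspace (F q)) M t (p + 1) := by
  have conj_inf_le (j : ℤ) : R.conjSubspace (F (j - p)) ⊓ M j ≤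
      oppositeFiltration (fun q => R.conjSubspace (F q)) M t (p + 1) := by
    refine le_iSup₂_of_le (min j t) (min_le_right _ _) (inf_le_inf (h.antitone_conj (by lia)) ?_)
    rcases min_choice j t with hj | hj <;> rw [hj]
    exact ht ▸ le_top
  refine inf_le_right.trans (sup_le ?_ (iSup_le fun i => ?_))
  · refine le_trans (inf_le_inf_right _ (h.antitone_conj ?_)) (conj_inf_le (p + q))
    lia
  · refine le_trans (inf_le_inf_right _ (h.antitone_conj ?_)) (conj_inf_le _)
    lia

theorem opposite_le_of_lt (h : IsMixedHodgeStructure R F M) (p q : ℤ) :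
    oppositeFiltration (fun q => R.conjSubspace (F q)) M (p + q - 1) p ≤
      (R.conjSubspace (F q) ⊓ M (p + q)) ⊔
        ⨆ i : ℕ, R.conjSubspace (F (q - (i + 1))) ⊓ M (p + q - (i + 1) - 1) := by
  refine iSup₂_le fun j hj => ?_
  rcases hj.eq_or_lt with rfl | hj
  · exact le_sup_of_le_left (inf_le_inf (h.antitone_conj (by lia)) (h.inc.mono (by lia)))
  · refine le_sup_of_le_right (le_iSup_of_le (p + q - 2 - j).toNat ?_)
    exact inf_le_inf (h.antitone_conj (by lia)) (h.inc.mono (by lia))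

theorem inf_opposite_le_hodgeU (h : IsMixedHodgeStructure R F M) (hb : M b = ⊥) (m p : ℤ) :
    F p ⊓ oppositeFiltration (fun q => R.conjSubspace (F q)) M m (p + 1) ≤ hodgeU R F M p := by
  rcases le_total m b with hm | hm
  · rw [oppositeFiltration_eq_bot h.inc.mono hb hm, inf_bot_eq]
    exact bot_le
  induction m, hm using Int.leInduction with
  | base =>
    rw [oppositeFiltration_eq_bot h.inc.mono hb le_rfl, inf_bot_eq]
    exact bot_le
  | succ m _ ih =>
    rintro x ⟨hxF, hx⟩
    have hxM := oppositeFiltration_le h.inc.mono _ _ hx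
    rw [oppositeFiltration_eq_sup, add_sub_cancel_right, add_sub_add_right_eq_sub] at hx
    obtain ⟨g, hg, a, ha, rfl⟩ := Submodule.mem_sup.1 hx
    -- Correcting `g + a` by an element `f` of `F^p ∩ M_m` moves it into `I^{p, m+1-p}`.
    obtain ⟨f, hf, a', ha', rfl⟩ := Submodule.mem_sup.1
      (h.le_inf_sup_opposite m p (oppositeFiltration_le h.inc.mono _ _ ha))
    have hfU : f ∈ hodgeU R F M p := by
      refine ih ⟨hf.1, (Submodule.add_mem_iff_left _ ?_).1 ha⟩
      exact oppositeFiltration_mono h.antitone_conj m (Int.le_add_one le_rfl) ha'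
    have e : p + (m + 1 - p) = m + 1 := by ring
    have hgI : g + a' ∈ deligneI R F M p (m + 1 - p) := by
      have ha'' := h.opposite_le_of_lt p (m + 1 - p)
      rw [e, add_sub_cancel_right] at ha''
      have eq_sub : g + a' = g + (f + a') - f := by abel
      refine ⟨⟨?_, ?_⟩, ?_⟩
      · exact eq_sub ▸ sub_mem hxF hf.1
      · exact e.symm ▸ eq_sub ▸ sub_mem hxM (h.inc.mono (by lia) hf.2)
      · rw [e]
        exact add_mem (Submodule.mem_sup_left hg) (ha'' ha')
    rw [add_left_comm]
    exact add_mem hfU (Submodule.mem_iSup_of_mem _ hgI)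

theorem hodgeU_eq (h : IsMixedHodgeStructure R F M) (ht : M t = ⊤) (p : ℤ) : hodgeU R F M p =
    F p ⊓ oppositeFiltration (fun q => R.conjSubspace (F q)) M t (p + 1) := by
  obtain ⟨b, hb⟩ := h.inc.bot
  refine le_antisymm (iSup_le fun q => ?_) (h.inf_opposite_le_hodgeU hb t p)
  exact le_inf (inf_le_left.trans inf_le_left) (h.deligneI_le_opposite ht p q)

theorem iSup_hodgeU (h : IsMixedHodgeStructure R F M) : ⨆ p, hodgeU R F M p = ⊤ := by
  obtain ⟨t, ht⟩ := h.inc.top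
  simp only [h.hodgeU_eq ht]
  exact iSup_inf_eq_top_of_opposite h.dec.anti (fun p => (h.isCompl_opposite ht p).codisjoint)
    h.dec.bot h.dec.top

theorem iSupIndep_hodgeU (h : IsMixedHodgeStructure R F M) : iSupIndep (hodgeU R F M) := by
  obtain ⟨t, ht⟩ := h.inc.top
  rw [funext (h.hodgeU_eq ht)]
  exact iSupIndep_inf_of_opposite h.dec.anti (oppositeFiltration_mono h.antitone_conj t)
    fun p => (h.isCompl_opposite ht p).disjoint

end IsMixedHodgeStructure

section MorphismsOfTypeMinusOne

variable {V : Type*} [NormedAddCommGroup V] [NormedSpace ℂ V] [Module ℚ V]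
  {R : RationalStructure V} {F M : ℤ → Submodule ℂ V} {N : V →ₗ[ℂ] V}

theorem map_deligneI_le (hR : ∀ v ∈ R.VQ, N v ∈ R.VQ) (hF : ∀ p, ∀ v ∈ F p, N v ∈ F (p - 1))
    (hM : ∀ k, ∀ v ∈ M k, N v ∈ M (k - 2)) (p q : ℤ) :
    deligneI R F M p q ≤ (deligneI R F M (p - 1) (q - 1)).comap N := by
  have conj_inf_le (a k : ℤ) : R.conjSubspace (F a) ⊓ M k ≤
      (R.conjSubspace (F (a - 1)) ⊓ M (k - 2)).comap N := by
    refine fun v hv => ⟨?_, hM k v hv.2⟩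
    exact Submodule.mem_comap.2 (R.conj_apply_comm N hR v ▸ hF a _ hv.1)
  have weight_eq : p - 1 + (q - 1) = p + q - 2 := by ring
  rw [deligneI, deligneI, Submodule.comap_inf, Submodule.comap_inf, weight_eq]
  refine inf_le_inf (inf_le_inf (hF p) (hM _)) (sup_le ?_ (iSup_le fun i => ?_))
  · exact (conj_inf_le _ _).trans (Submodule.comap_mono le_sup_left)
  · refine (conj_inf_le _ _).trans (Submodule.comap_mono (le_sup_of_le_right (le_iSup_of_le i ?_)))
    rw [sub_right_comm q, sub_right_comm (p + q - _) 1, sub_right_comm (p + q) _ 2]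

theorem map_hodgeU_le (hR : ∀ v ∈ R.VQ, N v ∈ R.VQ) (hF : ∀ p, ∀ v ∈ F p, N v ∈ F (p - 1))
    (hM : ∀ k, ∀ v ∈ M k, N v ∈ M (k - 2)) (p : ℤ) :
    hodgeU R F M p ≤ (hodgeU R F M (p - 1)).comap N :=
  iSup_le fun q => (map_deligneI_le hR hF hM p q).trans
    (Submodule.comap_mono (le_iSup (deligneI R F M (p - 1)) (q - 1)))

end MorphismsOfTypeMinusOne

/-! ### Holomorphic functions of several variables -/

theorem completeSpace_of_finiteDimensional_complex {E : Type*} [NormedAddCommGroup E]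
    [NormedSpace ℂ E] [FiniteDimensional ℂ E] : CompleteSpace E :=
  FiniteDimensional.complete ℂ E

attribute [local instance] completeSpace_of_finiteDimensional_complex

section SeveralComplexVariables

open Filter MeasureTheory Metric Set
open scoped Topology Real

variable {H E : Type*} [NormedAddCommGroup H] [NormedSpace ℂ H] [NormedAddCommGroup E]
  [NormedSpace ℂ E] {f : H → E} {U : Set H} {x v w : H} {R ρ : ℝ}

theorem exists_ball_norm_fderiv_le (hU : IsOpen U) (hf : DifferentiableOn ℂ f U) (hx : x ∈ U) :
    ∃ R > 0, ball x R ⊆ U ∧ ∃ C, ∀ y ∈ ball x R, ‖fderiv ℂ f y‖ ≤ C := by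
  have preimage_mem : f ⁻¹' ball (f x) 1 ∈ 𝓝 x :=
    (hf.differentiableAt (hU.mem_nhds hx)).continuousAt (ball_mem_nhds _ one_pos)
  obtain ⟨R, hR, hball⟩ := Metric.mem_nhds_iff.1 (inter_mem (hU.mem_nhds hx) preimage_mem)
  refine ⟨R / 2, half_pos hR, fun y hy => (hball (ball_subset_ball (by linarith) hy)).1,
    2 / (R / 2), fun y hy => ?_⟩
  have ball_subset : ball y (R / 2) ⊆ ball x R := ball_subset_ball' (by linarith [mem_ball.1 hy])
  refine Complex.norm_fderiv_le_div_of_mapsTo_ball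
    (hf.mono fun z hz => (hball (ball_subset hz)).1) (fun z hz => ?_) (half_pos hR)
  have hz' := mem_ball.1 (hball (ball_subset hz)).2
  have hy' := mem_ball.1 (hball (ball_subset_ball (by linarith) hy)).2
  exact mem_closedBall.2 (by linarith [dist_triangle_right (f z) (f y) (f x)])

theorem add_smul_mem_ball {y : H} {z : ℂ} (hy : y ∈ ball x (R / 2)) (hz : ‖z‖ * ‖v‖ < R / 2) :
    y + z • v ∈ ball x R := by
  refine mem_ball.2 ((dist_triangle _ y _).trans_lt ?_)
  rw [dist_self_add_left, norm_smul]
  linarith [mem_ball.1 hy]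

theorem fderiv_apply_eq_circleIntegral [CompleteSpace E] (hf : DifferentiableOn ℂ f (ball x R))
    {y : H} (hy : y ∈ ball x (R / 2)) (hρ : 0 < ρ) (hv : ρ * ‖v‖ < R / 2) :
    fderiv ℂ f y v =
      (2 * π * Complex.I : ℂ)⁻¹ • ∮ z in C(0, ρ), ((z - 0) ^ 2)⁻¹ • f (y + z • v) := by
  have line_continuous : Continuous fun z : ℂ => y + z • v := by fun_prop
  have closedBall_subset : closedBall (0 : ℂ) ρ ⊆ (fun z : ℂ => y + z • v) ⁻¹' ball x R :=
    fun z hz => add_smul_mem_ball hy <|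
      (mul_le_mul_of_nonneg_right (mem_closedBall_zero_iff.1 hz) (norm_nonneg v)).trans_lt hv
  have comp_differentiableOn : DifferentiableOn ℂ (fun z : ℂ => f (y + z • v))
      ((fun z : ℂ => y + z • v) ⁻¹' ball x R) :=
    hf.comp (by fun_prop) fun z hz => hz
  rw [Complex.two_pi_I_inv_smul_circleIntegral_sub_sq_inv_smul_of_differentiable
    (isOpen_ball.preimage line_continuous) closedBall_subset comp_differentiableOn
    (mem_ball_self hρ)]
  have hfy : HasFDerivAt f (fderiv ℂ f y) (y + (0 : ℂ) • v) := by
    have hyR := closedBall_subset (mem_closedBall_self hρ.le)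
    simp only [mem_preimage, zero_smul, add_zero] at hyR ⊢
    exact (hf.differentiableAt (isOpen_ball.mem_nhds hyR)).hasFDerivAt
  have hline : HasDerivAt (fun z : ℂ => y + z • v) v 0 := by
    simpa using ((hasDerivAt_id (0 : ℂ)).smul_const v).const_add y
  exact (hfy.comp_hasDerivAt (0 : ℂ) hline).deriv.symm

variable [FiniteDimensional ℂ H] [FiniteDimensional ℂ E]

theorem differentiableAt_circleIntegral_add_smul (hf : DifferentiableOn ℂ f (ball x R)) {C : ℝ}
    (hC : ∀ y ∈ ball x R, ‖fderiv ℂ f y‖ ≤ C) (hR : 0 < R) (hρ : 0 ≤ ρ) (hv : ρ * ‖v‖ < R / 2)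
    {k : ℂ → ℂ} (hk : ContinuousOn k (sphere 0 ρ)) :
    DifferentiableAt ℂ (fun y => ∮ z in C(0, ρ), k z • f (y + z • v)) x := by
  set e : ℝ → ℂ := circleMap 0 ρ
  set κ : ℝ → ℂ := fun θ => deriv e θ * k (e θ)
  have e_continuous : Continuous e := continuous_circleMap 0 ρ
  have κ_continuous : Continuous κ := by
    have deriv_e : deriv e = fun θ => e θ * Complex.I := by ext θ; simp [e, deriv_circleMap]
    refine .mul (by rw [deriv_e]; fun_prop)
      (hk.comp_continuous e_continuous fun θ => circleMap_mem_sphere 0 hρ θ)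
  have norm_e (θ : ℝ) : ‖e θ‖ = ρ := by simp [e, abs_of_nonneg hρ]
  have mem_ball_of_mem {y : H} (hy : y ∈ ball x (R / 2)) (θ : ℝ) : y + e θ • v ∈ ball x R :=
    add_smul_mem_ball hy (by rwa [norm_e])
  have integrand_continuous {y : H} (hy : y ∈ ball x (R / 2)) :
      Continuous fun θ => κ θ • f (y + e θ • v) :=
    κ_continuous.smul (hf.continuousOn.comp_continuous (by fun_prop) (mem_ball_of_mem hy))
  have integrand_hasFDerivAt {y : H} (hy : y ∈ ball x (R / 2)) (θ : ℝ) :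
      HasFDerivAt (fun y => κ θ • f (y + e θ • v)) (κ θ • fderiv ℂ f (y + e θ • v)) y :=
    ((hasFDerivAt_comp_add_right _).2 (hf.differentiableAt
      (isOpen_ball.mem_nhds (mem_ball_of_mem hy θ))).hasFDerivAt).const_smul _
  let : NormedSpace ℝ E := NormedSpace.restrictScalars ℝ ℂ E
  have : ProperSpace (H →L[ℂ] E) := FiniteDimensional.proper ℂ _
  borelize H
  have hx : ball x (R / 2) ∈ 𝓝 x := ball_mem_nhds x (half_pos hR)
  have hint := intervalIntegral.hasFDerivAt_integral_of_dominated_of_fderiv_le (𝕜 := ℂ)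
    (μ := volume) (a := 0) (b := 2 * π) (bound := fun θ => ‖κ θ‖ * C)
    (F := fun y θ => κ θ • f (y + e θ • v)) (F' := fun y θ => κ θ • fderiv ℂ f (y + e θ • v)) hx
    (eventually_of_mem hx fun y hy => (integrand_continuous hy).aestronglyMeasurable)
    ((integrand_continuous (mem_of_mem_nhds hx)).intervalIntegrable _ _)
    (κ_continuous.aestronglyMeasurable.smul ((measurable_fderiv ℂ f).comp
      (by fun_prop : Measurable fun θ => x + e θ • v)).aestronglyMeasurable)
    (.of_forall fun θ _ y hy => ?_)
    ((by fun_prop : Continuous fun θ => ‖κ θ‖ * C).intervalIntegrable _ _)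
    (.of_forall fun θ _ y hy => integrand_hasFDerivAt hy θ)
  · simpa only [circleIntegral, smul_smul] using hint.differentiableAt
  · rw [norm_smul]
    exact mul_le_mul_of_nonneg_left (hC _ (mem_ball_of_mem hy θ)) (norm_nonneg _)

theorem differentiableOn_fderiv_apply (hU : IsOpen U) (hf : DifferentiableOn ℂ f U) (v : H) :
    DifferentiableOn ℂ (fun y => fderiv ℂ f y v) U := by
  intro x hx
  obtain ⟨R, hR, hRU, C, hC⟩ := exists_ball_norm_fderiv_le hU hf hx
  obtain ⟨ρ, hρ, hv⟩ : ∃ ρ > 0, ρ * ‖v‖ < R / 2 := by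
    refine ⟨R / 2 / (‖v‖ + 1), by positivity, ?_⟩
    rw [div_mul_eq_mul_div, div_lt_iff₀ (by positivity)]
    linarith
  refine (DifferentiableAt.congr_of_eventuallyEq ?_ (eventually_of_mem
    (ball_mem_nhds x (half_pos hR)) fun y hy =>
      fderiv_apply_eq_circleIntegral (hf.mono hRU) hy hρ hv)).differentiableWithinAt
  refine (differentiableAt_circleIntegral_add_smul (hf.mono hRU) hC hR hρ.le hv
    (ContinuousOn.inv₀ (by fun_prop) fun z hz => ?_)).const_smul _
  simpa using ne_of_mem_sphere hz hρ.ne'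

theorem differentiableOn_fderiv (hU : IsOpen U) (hf : DifferentiableOn ℂ f U) :
    DifferentiableOn ℂ (fderiv ℂ f) U := by
  have b := Module.finBasis ℂ H
  have fderiv_eq_sum : fderiv ℂ f = fun y => ∑ i,
      (b.coord i).toContinuousLinearMap.smulRight (fderiv ℂ f y (b i)) := by
    ext y v
    conv_lhs => rw [← b.sum_repr v, map_sum]
    simp
  rw [fderiv_eq_sum]
  refine DifferentiableOn.fun_sum fun i _ => ?_
  exact (ContinuousLinearMap.smulRightL ℂ H E (b.coord i).toContinuousLinearMap).differentiable
    |>.comp_differentiableOn (differentiableOn_fderiv_apply hU hf (b i))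

theorem fderiv_fderiv_comm (hU : IsOpen U) (hf : DifferentiableOn ℂ f U) (hx : x ∈ U) (v w : H) :
    fderiv ℂ (fun y => fderiv ℂ f y v) x w = fderiv ℂ (fun y => fderiv ℂ f y w) x v := by
  have hdf := (differentiableOn_fderiv hU hf).differentiableAt (hU.mem_nhds hx)
  have fderiv_apply (v w : H) :
      fderiv ℂ (fun y => fderiv ℂ f y v) x w = fderiv ℂ (fderiv ℂ f) x w v := by
    simp [fderiv_clm_apply hdf (differentiableAt_const v)]
  rw [fderiv_apply, fderiv_apply]
  refine second_derivative_symmetric_of_eventually (f := f) ?_ hdf.hasFDerivAt w v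
  filter_upwards [hU.mem_nhds hx] with y hy
  exact (hf.differentiableAt (hU.mem_nhds hy)).hasFDerivAt

end SeveralComplexVariables

/-! ### The logarithmic Poincaré lemma on a polydisk -/

section Polydisk

open Filter MeasureTheory Metric Set
open scoped Topology

variable {n : ℕ} {r : ℝ} {s : Fin n → ℂ} {t : ℝ}

theorem polydisk_eq_pi : polydisk n r = univ.pi fun _ => ball 0 r := by ext; simp [polydisk]

theorem puncturedPolydisk_eq_inter :
    puncturedPolydisk n r = polydisk n r ∩ univ.pi fun _ => {0}ᶜ := by
  ext; simp [puncturedPolydisk]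

theorem isOpen_polydisk : IsOpen (polydisk n r) :=
  polydisk_eq_pi (n := n) ▸ isOpen_set_pi finite_univ fun _ _ => isOpen_ball

theorem convex_polydisk : Convex ℝ (polydisk n r) :=
  polydisk_eq_pi (n := n) ▸ convex_pi fun _ _ => convex_ball _ _

theorem zero_mem_polydisk (hr : 0 < r) : (0 : Fin n → ℂ) ∈ polydisk n r := fun j => by
  simpa using hr

theorem smul_mem_polydisk (hs : s ∈ polydisk n r) (ht₀ : 0 ≤ t) (ht₁ : t ≤ 1) :
    (t : ℂ) • s ∈ polydisk n r := fun j => by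
  rw [Pi.smul_apply, norm_smul, Complex.norm_real, Real.norm_of_nonneg ht₀]
  exact (mul_le_of_le_one_left (norm_nonneg _) ht₁).trans_lt (hs j)

theorem smul_mem_puncturedPolydisk (hs : s ∈ puncturedPolydisk n r) (ht₀ : 0 < t) (ht₁ : t ≤ 1) :
    (t : ℂ) • s ∈ puncturedPolydisk n r :=
  ⟨smul_mem_polydisk hs.1 ht₀.le ht₁, fun j =>
    smul_ne_zero (Complex.ofReal_ne_zero.2 ht₀.ne') (hs.2 j)⟩

theorem isOpen_puncturedPolydisk : IsOpen (puncturedPolydisk n r) :=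
  puncturedPolydisk_eq_inter (n := n) ▸
    isOpen_polydisk.inter (isOpen_set_pi finite_univ fun _ _ => isOpen_compl_singleton)

theorem polydisk_subset_closure : polydisk n r ⊆ closure (puncturedPolydisk n r) :=
  puncturedPolydisk_eq_inter (n := n) ▸
    (dense_pi univ fun _ _ => dense_compl_singleton 0).open_subset_closure_inter isOpen_polydisk

theorem eqOn_polydisk {X : Type*} [TopologicalSpace X] [T2Space X] {f g : (Fin n → ℂ) → X}
    (hf : ContinuousOn f (polydisk n r)) (hg : ContinuousOn g (polydisk n r))
    (h : EqOn f g (puncturedPolydisk n r)) : EqOn f g (polydisk n r) :=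
  h.of_subset_closure hf hg (fun _ hs => hs.1) polydisk_subset_closure

variable {E : Type*} [NormedAddCommGroup E] [NormedSpace ℂ E] {f : (Fin n → ℂ) → E}

/-- The logarithmic derivation `s_j ∂/∂s_j`. -/
def eulerDeriv (j : Fin n) (f : (Fin n → ℂ) → E) (s : Fin n → ℂ) : E :=
  s j • pderiv j f s

theorem fderiv_apply_eq_sum (f : (Fin n → ℂ) → E) (s v : Fin n → ℂ) :
    fderiv ℂ f s v = ∑ j, v j • pderiv j f s := by
  conv_lhs => rw [pi_eq_sum_univ' v, map_sum]
  simp only [map_smul, pderiv]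

theorem smul_fderiv_smul_apply (f : (Fin n → ℂ) → E) (s : Fin n → ℂ) (c : ℂ) :
    c • fderiv ℂ f (c • s) s = ∑ j, eulerDeriv j f (c • s) := by
  simp only [fderiv_apply_eq_sum, Finset.smul_sum, eulerDeriv, smul_smul, Pi.smul_apply,
    smul_eq_mul]

theorem hasDerivAt_ray (hf : DifferentiableOn ℂ f (polydisk n r))
    (hs : (t : ℂ) • s ∈ polydisk n r) :
    HasDerivAt (fun u : ℝ => f ((u : ℂ) • s)) (fderiv ℂ f ((t : ℂ) • s) s) t := by
  have hfs := (hf.differentiableAt (isOpen_polydisk.mem_nhds hs)).hasFDerivAt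
  have hray : HasDerivAt (fun u : ℝ => (u : ℂ) • s) s t := by
    simpa using (Complex.ofRealCLM.hasDerivAt (x := t)).smul_const s
  exact (hfs.restrictScalars ℝ).comp_hasDerivAt t hray

theorem intervalIntegrable_inv_smul_ray (hf : DifferentiableOn ℂ f (polydisk n r)) (hf₀ : f 0 = 0)
    (hs : s ∈ polydisk n r) :
    IntervalIntegrable (fun t : ℝ => (t : ℂ)⁻¹ • f ((t : ℂ) • s)) volume 0 1 := by
  set g : ℝ → E := fun t => f ((t : ℂ) • s)
  set S : Set ℝ := (fun t : ℝ => (t : ℂ) • s) ⁻¹' polydisk n r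
  have isOpen_S : IsOpen S := isOpen_polydisk.preimage (by fun_prop)
  have uIcc_subset : uIcc 0 1 ⊆ S := by
    rw [uIcc_of_le zero_le_one]
    exact fun t ht => smul_mem_polydisk hs ht.1 ht.2
  have hg {t : ℝ} (ht : t ∈ S) : HasDerivAt g _ t := hasDerivAt_ray hf ht
  have hS₀ : 0 ∈ S := uIcc_subset left_mem_uIcc
  have dslope_continuousOn : ContinuousOn (dslope g 0) S :=
    (continuousOn_dslope (isOpen_S.mem_nhds hS₀)).2
      ⟨fun t ht => (hg ht).continuousAt.continuousWithinAt, (hg hS₀).differentiableAt⟩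
  refine (intervalIntegrable_congr fun t ht => ?_).1
    (dslope_continuousOn.mono uIcc_subset).intervalIntegrable
  rw [uIoc_of_le zero_le_one] at ht
  rw [dslope_of_ne g ht.1.ne', slope_def_module]
  simp [g, hf₀, ← Complex.ofReal_inv]

/-- The integral `∫₀¹ B(ts) dt/t` along the ray through `s`; for `B` holomorphic with `B(0) = 0`,
it inverts the Euler vector field `∑ s_j ∂/∂s_j`. -/
def rayIntegral (B : (Fin n → ℂ) → E) (s : Fin n → ℂ) : E :=
  ∫ t in (0 : ℝ)..1, (t : ℂ)⁻¹ • B ((t : ℂ) • s)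

variable [FiniteDimensional ℂ E]

theorem eqOn_of_eulerDeriv_eq_zero (hf : DifferentiableOn ℂ f (polydisk n r))
    (h : ∀ s ∈ puncturedPolydisk n r, ∀ j, eulerDeriv j f s = 0) :
    EqOn f (fun _ => f 0) (polydisk n r) := by
  have fderiv_eq_zero : EqOn (fderiv ℂ f) 0 (polydisk n r) := by
    refine eqOn_polydisk (differentiableOn_fderiv isOpen_polydisk hf).continuousOn
      continuousOn_const fun s hs => ContinuousLinearMap.ext fun v => ?_
    rw [fderiv_apply_eq_sum]
    exact Finset.sum_eq_zero fun j _ => by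
      rw [(smul_eq_zero_iff_right (hs.2 j)).1 (h s hs j), smul_zero]
  intro s hs
  have zero_mem : (0 : Fin n → ℂ) ∈ polydisk n r := by
    simpa using smul_mem_polydisk hs le_rfl zero_le_one
  exact isOpen_polydisk.is_const_of_fderiv_eq_zero convex_polydisk.isPreconnected hf
    fderiv_eq_zero hs zero_mem

theorem exists_norm_fderiv_ray_le (hf : DifferentiableOn ℂ f (polydisk n r))
    (hs : s ∈ polydisk n r) : ∃ K ∈ 𝓝 s, K ⊆ polydisk n r ∧
      ∃ C : ℝ, ∀ x ∈ K, ∀ t ∈ Icc (0 : ℝ) 1, ‖fderiv ℂ f ((t : ℂ) • x)‖ ≤ C := by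
  obtain ⟨δ, hδ, hsub⟩ := nhds_basis_closedBall.mem_iff.1 (isOpen_polydisk.mem_nhds hs)
  have isCompact_rays : IsCompact ((fun p : ℝ × (Fin n → ℂ) => (p.1 : ℂ) • p.2) ''
      (Icc 0 1 ×ˢ closedBall s δ)) :=
    (isCompact_Icc.prod (isCompact_closedBall s δ)).image (by fun_prop)
  obtain ⟨C, hC⟩ := isCompact_rays.exists_bound_of_continuousOn (f := fderiv ℂ f)
    ((differentiableOn_fderiv isOpen_polydisk hf).continuousOn.mono (by
      rintro _ ⟨⟨t, x⟩, ⟨ht, hx⟩, rfl⟩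
      exact smul_mem_polydisk (hsub hx) ht.1 ht.2))
  exact ⟨closedBall s δ, closedBall_mem_nhds s hδ, hsub, C,
    fun x hx t ht => hC _ ⟨(t, x), ⟨ht, hx⟩, rfl⟩⟩

theorem intervalIntegrable_fderiv_ray (hf : DifferentiableOn ℂ f (polydisk n r))
    (hs : s ∈ polydisk n r) :
    IntervalIntegrable (fun t : ℝ => fderiv ℂ f ((t : ℂ) • s)) volume 0 1 := by
  refine ContinuousOn.intervalIntegrable ?_
  rw [uIcc_of_le zero_le_one]
  exact (differentiableOn_fderiv isOpen_polydisk hf).continuousOn.comp (by fun_prop)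
    fun t ht => smul_mem_polydisk hs ht.1 ht.2

theorem hasFDerivAt_rayIntegral (hf : DifferentiableOn ℂ f (polydisk n r)) (hf₀ : f 0 = 0)
    (hs : s ∈ polydisk n r) :
    HasFDerivAt (rayIntegral f) (∫ t in (0 : ℝ)..1, fderiv ℂ f ((t : ℂ) • s)) s := by
  obtain ⟨K, hK, hKsub, C, hC⟩ := exists_norm_fderiv_ray_le hf hs
  refine intervalIntegral.hasFDerivAt_integral_of_dominated_of_fderiv_le (𝕜 := ℂ)
    (F := fun x t => (t : ℂ)⁻¹ • f ((t : ℂ) • x)) (bound := fun _ => C)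
    (F' := fun x t => fderiv ℂ f ((t : ℂ) • x)) hK
    (eventually_of_mem hK fun x hx =>
      (intervalIntegrable_inv_smul_ray hf hf₀ (hKsub hx)).def'.aestronglyMeasurable)
    (intervalIntegrable_inv_smul_ray hf hf₀ hs)
    (intervalIntegrable_fderiv_ray hf hs).def'.aestronglyMeasurable
    (.of_forall fun t ht x hx => ?_) intervalIntegrable_const (.of_forall fun t ht x hx => ?_)
  all_goals rw [uIoc_of_le zero_le_one] at ht
  · exact hC x hx t ⟨ht.1.le, ht.2⟩
  · have hft := (hf.differentiableAt (isOpen_polydisk.mem_nhds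
      (smul_mem_polydisk (hKsub hx) ht.1.le ht.2))).hasFDerivAt
    refine ((hft.comp x ((hasFDerivAt_id x).const_smul (t : ℂ))).const_smul
      (t : ℂ)⁻¹).congr_fderiv ?_
    ext v
    have ht₀ : (t : ℂ) ≠ 0 := Complex.ofReal_ne_zero.2 ht.1.ne'
    change (t : ℂ)⁻¹ • fderiv ℂ f ((t : ℂ) • x) ((t : ℂ) • v) = fderiv ℂ f ((t : ℂ) • x) v
    rw [map_smul, inv_smul_smul₀ ht₀]

theorem integral_fderiv_ray_apply (hf : DifferentiableOn ℂ f (polydisk n r))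
    (hs : s ∈ polydisk n r) :
    ∫ t in (0 : ℝ)..1, fderiv ℂ f ((t : ℂ) • s) s = f s - f 0 := by
  have uIcc_mem {t : ℝ} (ht : t ∈ uIcc (0 : ℝ) 1) : (t : ℂ) • s ∈ polydisk n r := by
    rw [uIcc_of_le zero_le_one] at ht
    exact smul_mem_polydisk hs ht.1 ht.2
  have fderiv_continuousOn :
      ContinuousOn (fun t : ℝ => fderiv ℂ f ((t : ℂ) • s) s) (uIcc 0 1) :=
    ((differentiableOn_fderiv isOpen_polydisk hf).continuousOn.comp (by fun_prop)
      fun t ht => uIcc_mem ht).clm_apply continuousOn_const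
  rw [intervalIntegral.integral_eq_sub_of_hasDerivAt
    (fun t ht => hasDerivAt_ray hf (uIcc_mem ht)) fderiv_continuousOn.intervalIntegrable]
  simp

theorem exists_log_primitive {b : Fin n → (Fin n → ℂ) → E}
    (hb : ∀ j, DifferentiableOn ℂ (b j) (polydisk n r)) (hb₀ : ∀ j, b j 0 = 0)
    (hclosed : ∀ s ∈ puncturedPolydisk n r, ∀ i j,
      eulerDeriv i (b j) s = eulerDeriv j (b i) s) :
    ∃ f : (Fin n → ℂ) → E, DifferentiableOn ℂ f (polydisk n r) ∧ f 0 = 0 ∧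
      ∀ s ∈ puncturedPolydisk n r, ∀ j, eulerDeriv j f s = b j s := by
  set B : (Fin n → ℂ) → E := fun s => ∑ i, b i s
  have hB : DifferentiableOn ℂ B (polydisk n r) := DifferentiableOn.fun_sum fun i _ => hb i
  have hB₀ : B 0 = 0 := by simp [B, hb₀]
  have eulerDeriv_B {s} (hs : s ∈ puncturedPolydisk n r) (j : Fin n) :
      eulerDeriv j B s = ∑ i, eulerDeriv i (b j) s := by
    rw [eulerDeriv, pderiv, fderiv_fun_sum fun i _ =>
      (hb i).differentiableAt (isOpen_polydisk.mem_nhds hs.1)]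
    simp only [sum_apply, Finset.smul_sum]
    exact Finset.sum_congr rfl fun i _ => hclosed s hs j i
  refine ⟨rayIntegral B,
    fun s hs => (hasFDerivAt_rayIntegral hB hB₀ hs).differentiableAt.differentiableWithinAt,
    by simp [rayIntegral, hB₀], fun s hs j => ?_⟩
  rw [eulerDeriv, pderiv, (hasFDerivAt_rayIntegral hB hB₀ hs.1).fderiv,
    ContinuousLinearMap.intervalIntegral_apply (intervalIntegrable_fderiv_ray hB hs.1),
    ← intervalIntegral.integral_smul, ← sub_zero (b j s), ← hb₀ j,
    ← integral_fderiv_ray_apply (hb j) hs.1]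
  refine intervalIntegral.integral_congr_ae (.of_forall fun t ht => ?_)
  rw [uIoc_of_le zero_le_one] at ht
  refine smul_right_injective E (Complex.ofReal_ne_zero.2 ht.1.ne') ?_
  change (t : ℂ) • (s j • pderiv j B ((t : ℂ) • s)) = (t : ℂ) • fderiv ℂ (b j) ((t : ℂ) • s) s
  rw [smul_fderiv_smul_apply, smul_smul]
  exact eulerDeriv_B (smul_mem_puncturedPolydisk hs ht.1 ht.2) j

end Polydisk

/-! ### The exponential in a Banach algebra -/

section Subspaces

variable {E : Type*} [NormedAddCommGroup E] [NormedSpace ℂ E] [FiniteDimensional ℂ E]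

theorem mem_of_hasSum {Q : Submodule ℂ E} {f : ℕ → E} {x : E} (h : HasSum f x)
    (hf : ∀ k, f k ∈ Q) : x ∈ Q :=
  Q.closed_of_finiteDimensional.mem_of_tendsto h
    (.of_forall fun _ => Q.sum_mem fun k _ => hf k)

theorem exists_clm_ker_eq (Q : Submodule ℂ E) :
    ∃ p : E →L[ℂ] E, LinearMap.ker (p : E →ₗ[ℂ] E) = Q := by
  obtain ⟨C, hC⟩ := Q.exists_isCompl
  exact ⟨LinearMap.toContinuousLinearMap (C.projection Q hC.symm),
    Submodule.ker_projection hC.symm⟩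

end Subspaces

section Exponential

open Filter MeasureTheory NormedSpace
open scoped Topology

variable {A : Type*} [NormedRing A] [NormedAlgebra ℂ A]

/-- The adjoint operator `[x, ·]` of an element of a normed algebra; on `V →L[ℂ] V` it is `adOp`. -/
def adjointOp (x : A) : A →L[ℂ] A :=
  ContinuousLinearMap.mul ℂ A x - (ContinuousLinearMap.mul ℂ A).flip x

variable [CompleteSpace A]

theorem exp_hasSum (x : A) : HasSum (fun k => ((k.factorial : ℂ))⁻¹ • x ^ k) (exp x) :=
  NormedSpace.exp_series_hasSum_exp' x

theorem exp_add_of_commute {x y : A} (h : Commute x y) : exp (x + y) = exp x * exp y :=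
  let _ := NormedAlgebra.restrictScalars ℚ ℂ A
  NormedSpace.exp_add_of_commute h

theorem exp_neg_mul_exp (x : A) : exp (-x) * exp x = 1 := by
  rw [← exp_add_of_commute (Commute.refl x).neg_left, neg_add_cancel, NormedSpace.exp_zero]

theorem exp_mul_exp_neg (x : A) : exp x * exp (-x) = 1 := by
  simpa using exp_neg_mul_exp (-x)

theorem differentiable_exp : Differentiable ℂ (exp : A → A) := fun x =>
  (exp_analytic (𝕂 := ℂ) x).differentiableAt

theorem continuous_exp : Continuous (exp : A → A) := differentiable_exp.continuous

theorem exp_mulLeft_apply (x y : A) : exp (ContinuousLinearMap.mul ℂ A x) y = exp x * y := by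
  have pow_apply (k : ℕ) : (ContinuousLinearMap.mul ℂ A x ^ k) y = x ^ k * y := by
    induction k with
    | zero => simp
    | succ k ih => rw [pow_succ', pow_succ', mul_assoc, ← ih]; rfl
  have hasSum_exp := (exp_hasSum (ContinuousLinearMap.mul ℂ A x)).mapL
    (ContinuousLinearMap.apply ℂ A y)
  refine hasSum_exp.unique (((exp_hasSum x).mul_right y).congr_fun fun k => ?_)
  simp [pow_apply]

theorem exp_mulRight_apply (x y : A) :
    exp ((ContinuousLinearMap.mul ℂ A).flip x) y = y * exp x := by
  have pow_apply (k : ℕ) : ((ContinuousLinearMap.mul ℂ A).flip x ^ k) y = y * x ^ k := by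
    induction k with
    | zero => simp
    | succ k ih => rw [pow_succ', pow_succ, ← mul_assoc, ← ih]; rfl
  have hasSum_exp := (exp_hasSum ((ContinuousLinearMap.mul ℂ A).flip x)).mapL
    (ContinuousLinearMap.apply ℂ A y)
  refine hasSum_exp.unique (((exp_hasSum x).mul_left y).congr_fun fun k => ?_)
  simp [pow_apply]

theorem exp_neg_adjointOp_apply (x y : A) : exp (-adjointOp x) y = exp (-x) * y * exp x := by
  have commute_mul : Commute (ContinuousLinearMap.mul ℂ A (-x))
      ((ContinuousLinearMap.mul ℂ A).flip x) :=
    ContinuousLinearMap.ext fun z => (mul_assoc (-x) z x).symm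
  have neg_adjointOp : -adjointOp x =
      ContinuousLinearMap.mul ℂ A (-x) + (ContinuousLinearMap.mul ℂ A).flip x := by
    rw [adjointOp, map_neg, neg_sub, sub_eq_neg_add]
  rw [neg_adjointOp, exp_add_of_commute commute_mul, mul_apply_eq_comp,
    exp_mulLeft_apply, exp_mulRight_apply, mul_assoc]

theorem hasDerivAt_exp_neg_smul_mul_exp_smul (x z : A) (t : ℝ) :
    HasDerivAt (fun u : ℝ => exp (-(u • x)) * exp (u • z))
      (exp (-(t • x)) * (z - x) * exp (t • z)) t := by
  simp only [← smul_neg]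
  refine ((hasDerivAt_exp_smul_const (-x) t).fun_mul
    (hasDerivAt_exp_smul_const' z t)).congr_deriv ?_
  noncomm_ring

/-- Duhamel's formula. -/
theorem exp_neg_mul_exp_sub_one (x z : A) :
    exp (-x) * exp z - 1 = ∫ t in (0 : ℝ)..1, exp (-(t • x)) * (z - x) * exp (t • z) := by
  have integrand_continuous : Continuous fun t : ℝ => exp (-(t • x)) * (z - x) * exp (t • z) :=
    ((continuous_exp.comp (by fun_prop)).mul continuous_const).mul
      (continuous_exp.comp (by fun_prop))
  rw [intervalIntegral.integral_eq_sub_of_hasDerivAt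
    (fun t _ => hasDerivAt_exp_neg_smul_mul_exp_smul x z t)
    (integrand_continuous.intervalIntegrable 0 1)]
  simp

theorem exp_neg_mul_fderiv_exp (x y : A) :
    exp (-x) * fderiv ℂ exp x y = ∫ t in (0 : ℝ)..1, exp (-(t • x)) * y * exp (t • x) := by
  set φ : ℂ → A := fun c => ∫ t in (0 : ℝ)..1, exp (-(t • x)) * y * exp (t • (x + c • y))
  have φ_continuous : Continuous φ := by
    refine intervalIntegral.continuous_parametric_intervalIntegral_of_continuous' ?_ 0 1
    exact ((continuous_exp.comp (by fun_prop)).mul continuous_const).mul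
      (continuous_exp.comp (by fun_prop))
  have slope_eq {c : ℂ} (hc : c ≠ 0) :
      c⁻¹ • (exp (-x) * exp (x + (0 + c) • y) - exp (-x) * exp (x + (0 : ℂ) • y)) = φ c := by
    rw [zero_add, zero_smul, add_zero, exp_neg_mul_exp, exp_neg_mul_exp_sub_one,
      inv_smul_eq_iff₀ hc, ← intervalIntegral.integral_smul]
    simp only [add_sub_cancel_left, mul_smul_comm, smul_mul_assoc]
  have hasDerivAt_line : HasDerivAt (fun c : ℂ => exp (-x) * exp (x + c • y))
      (exp (-x) * fderiv ℂ exp x y) 0 := by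
    have hline : HasDerivAt (fun c : ℂ => x + c • y) y 0 := by
      simpa using ((hasDerivAt_id (0 : ℂ)).smul_const y).const_add x
    have hexp : HasFDerivAt exp (fderiv ℂ exp x) (x + (0 : ℂ) • y) := by
      simpa using (differentiable_exp x).hasFDerivAt
    exact (hexp.comp_hasDerivAt 0 hline).const_mul (exp (-x))
  have slope_tendsto : Tendsto φ (𝓝[≠] 0) (𝓝 (exp (-x) * fderiv ℂ exp x y)) :=
    (hasDerivAt_iff_tendsto_slope_zero.1 hasDerivAt_line).congr'
      (eventually_mem_nhdsWithin.mono fun c hc => slope_eq hc)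
  have φ_tendsto : Tendsto φ (𝓝[≠] 0) (𝓝 (φ 0)) :=
    φ_continuous.continuousAt.tendsto.mono_left nhdsWithin_le_nhds
  simpa only [φ, zero_smul, add_zero] using tendsto_nhds_unique slope_tendsto φ_tendsto

omit [CompleteSpace A] in
theorem exp_neg_mul_fderiv_exp_mem [FiniteDimensional ℂ A] {Q : Submodule ℂ A} {x y : A}
    (h : ∀ t : ℝ, exp (-(t • x)) * y * exp (t • x) ∈ Q) :
    exp (-x) * fderiv ℂ exp x y ∈ Q := by
  obtain ⟨p, rfl⟩ := exists_clm_ker_eq Q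
  have integrand_continuous : Continuous fun t : ℝ => exp (-(t • x)) * y * exp (t • x) :=
    ((continuous_exp.comp (by fun_prop)).mul continuous_const).mul
      (continuous_exp.comp (by fun_prop))
  have map_integrand (t : ℝ) : p (exp (-(t • x)) * y * exp (t • x)) = 0 := h t
  change p _ = 0
  rw [exp_neg_mul_fderiv_exp,
    ← p.intervalIntegral_comp_comm (integrand_continuous.intervalIntegrable 0 1)]
  simp only [map_integrand, intervalIntegral.integral_zero]

end Exponential

/-! ### Graded algebras -/

open NormedSpace (exp)

attribute [local instance] LieRing.ofAssociativeRing

/-- A grading `⨁ E_k`, `k ≥ 0`, of a subalgebra of `A` with finitely many nonzero components,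
together with projections that are defined on all of `A`. -/
structure LowerGrading (A : Type*) [NormedRing A] [NormedAlgebra ℂ A] where
  E : ℕ → Submodule ℂ A
  proj : ℕ → A →L[ℂ] A
  proj_mem : ∀ k x, proj k x ∈ E k
  proj_same : ∀ k, ∀ x ∈ E k, proj k x = x
  proj_other : ∀ k l, k ≠ l → ∀ x ∈ E l, proj k x = 0
  mul_mem : ∀ k l, ∀ x ∈ E k, ∀ y ∈ E l, x * y ∈ E (k + l)
  one_mem : (1 : A) ∈ E 0
  exists_bound : ∃ K, ∀ k, K ≤ k → E k = ⊥

namespace LowerGrading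

variable {A : Type*} [NormedRing A] [NormedAlgebra ℂ A] (Gr : LowerGrading A)

/-- The sum of the components of degree at least `m`. -/
def tail (m : ℕ) : Submodule ℂ A := ⨆ k, ⨆ (_ : m ≤ k), Gr.E k

/-- The part `⨁_{k ≥ 1} E_k ∩ g` of a Lie subalgebra `g`. The degree `k` corresponds to `℘_{-k}`, so
this is the abstract form of `q_∞`. -/
def neg (g : LieSubalgebra ℂ A) : Submodule ℂ A := ⨆ k, ⨆ (_ : 1 ≤ k), Gr.E k ⊓ g.toSubmodule

/-- The sum of the components of degree `1, …, k - 1`. -/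
def trunc (k : ℕ) : A →L[ℂ] A := ∑ i ∈ Finset.Ico 1 k, Gr.proj i

variable {Gr} {k m : ℕ} {x y : A}

theorem E_le_tail (h : m ≤ k) : Gr.E k ≤ Gr.tail m := le_iSup₂_of_le k h le_rfl

theorem tail_antitone : Antitone Gr.tail := fun _ _ h =>
  iSup₂_le fun _ hj => E_le_tail (h.trans hj)

theorem one_mem_tail : (1 : A) ∈ Gr.tail 0 := E_le_tail le_rfl Gr.one_mem

theorem mul_mem_tail {l : ℕ} (hx : x ∈ Gr.tail k) (hy : y ∈ Gr.tail l) :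
    x * y ∈ Gr.tail (k + l) := by
  have tail_mul_le : Gr.tail k * Gr.tail l ≤ Gr.tail (k + l) := by
    simp only [tail, Submodule.iSup_mul, Submodule.mul_iSup]
    exact iSup₂_le fun a ha => iSup₂_le fun b hb => Submodule.mul_le.2 fun x hx y hy =>
      E_le_tail (add_le_add hb ha) (Gr.mul_mem _ _ x hx y hy)
  exact Submodule.mul_le.1 tail_mul_le x hx y hy

theorem pow_mem_tail (hx : x ∈ Gr.tail 1) (k : ℕ) : x ^ k ∈ Gr.tail k := by
  induction k with
  | zero => exact (pow_zero x).symm ▸ one_mem_tail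
  | succ k ih => exact (pow_succ x k).symm ▸ mul_mem_tail ih hx

theorem exists_tail_eq_bot (Gr : LowerGrading A) : ∃ K, 1 ≤ K ∧ Gr.tail K = ⊥ := by
  obtain ⟨K, hK⟩ := Gr.exists_bound
  exact ⟨K + 1, by simp, le_bot_iff.1 (iSup₂_le fun k hk => (hK k (by lia)).le)⟩

theorem proj_eq_zero_of_mem_tail (h : k < m) (hx : x ∈ Gr.tail m) : Gr.proj k x = 0 := by
  have tail_le_ker : Gr.tail m ≤ LinearMap.ker (Gr.proj k : A →ₗ[ℂ] A) :=
    iSup₂_le fun l hl x hx => Gr.proj_other k l (by lia) x hx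
  exact tail_le_ker hx

theorem sub_proj_mem_tail (hx : x ∈ Gr.tail m) : x - Gr.proj m x ∈ Gr.tail (m + 1) := by
  have tail_le_comap : Gr.tail m ≤
      (Gr.tail (m + 1)).comap (LinearMap.id - (Gr.proj m : A →ₗ[ℂ] A)) := by
    refine iSup₂_le fun l hl x hx => ?_
    change x - Gr.proj m x ∈ Gr.tail (m + 1)
    rcases hl.eq_or_lt with rfl | hl
    · rw [Gr.proj_same _ x hx, sub_self]
      exact zero_mem _
    · rw [Gr.proj_other m l hl.ne x hx, sub_zero]
      exact E_le_tail hl hx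
  exact tail_le_comap hx

theorem proj_eq_of_sub_mem_tail (h : x - y ∈ Gr.tail (k + 1)) : Gr.proj k x = Gr.proj k y := by
  rw [← sub_eq_zero, ← map_sub, proj_eq_zero_of_mem_tail k.lt_succ_self h]

theorem trunc_apply : Gr.trunc k x = ∑ i ∈ Finset.Ico 1 k, Gr.proj i x := by
  simp [trunc]

theorem trunc_one : Gr.trunc 1 x = 0 := by simp [trunc_apply]

theorem trunc_succ (hk : 1 ≤ k) : Gr.trunc (k + 1) x = Gr.trunc k x + Gr.proj k x := by
  rw [trunc_apply, trunc_apply, Finset.sum_Ico_succ_top hk]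

theorem proj_trunc : Gr.proj k (Gr.trunc k x) = 0 := by
  rw [trunc_apply, map_sum]
  exact Finset.sum_eq_zero fun i hi =>
    Gr.proj_other k i (Finset.mem_Ico.1 hi).2.ne' _ (Gr.proj_mem i x)

theorem sub_trunc_mem_tail (hx : x ∈ Gr.tail 1) (hk : 1 ≤ k) : x - Gr.trunc k x ∈ Gr.tail k := by
  induction k, hk using Nat.le_induction with
  | base => rwa [trunc_one, sub_zero]
  | succ k hk ih =>
    have := sub_proj_mem_tail ih
    rwa [map_sub, proj_trunc, sub_zero, sub_sub, ← trunc_succ hk] at this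

theorem exists_trunc_eq (Gr : LowerGrading A) : ∃ K, ∀ x ∈ Gr.tail 1, Gr.trunc K x = x := by
  obtain ⟨K, hK, tail_K⟩ := Gr.exists_tail_eq_bot
  refine ⟨K, fun x hx => ?_⟩
  have := sub_trunc_mem_tail hx hK
  rw [tail_K, Submodule.mem_bot, sub_eq_zero] at this
  exact this.symm

variable {g : LieSubalgebra ℂ A}

theorem inf_le_neg (hk : 1 ≤ k) : Gr.E k ⊓ g.toSubmodule ≤ Gr.neg g := le_iSup₂_of_le k hk le_rfl

theorem neg_le_tail : Gr.neg g ≤ Gr.tail 1 :=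
  iSup₂_le fun _ hk => inf_le_left.trans (E_le_tail hk)

theorem proj_mem_of_mem_neg (hx : x ∈ Gr.neg g) (k : ℕ) :
    Gr.proj k x ∈ Gr.E k ⊓ g.toSubmodule := by
  have neg_le_comap : Gr.neg g ≤
      (Gr.E k ⊓ g.toSubmodule).comap (Gr.proj k : A →ₗ[ℂ] A) := by
    refine iSup₂_le fun l _ x hx => ?_
    change Gr.proj k x ∈ Gr.E k ⊓ g.toSubmodule
    rcases eq_or_ne k l with rfl | hkl
    · rwa [Gr.proj_same k x hx.1]
    · rw [Gr.proj_other k l hkl x hx.1]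
      exact zero_mem _
  exact neg_le_comap hx

theorem trunc_mem_neg (hx : x ∈ Gr.neg g) (k : ℕ) : Gr.trunc k x ∈ Gr.neg g := by
  rw [trunc_apply]
  exact Submodule.sum_mem _ fun i hi =>
    inf_le_neg (Finset.mem_Ico.1 hi).1 (proj_mem_of_mem_neg hx i)

theorem lie_mem_neg (hx : x ∈ Gr.neg g) (hy : y ∈ Gr.neg g) : ⁅x, y⁆ ∈ Gr.neg g := by
  have map₂_le : Submodule.map₂ (LieModule.toEnd ℂ A A : A →ₗ[ℂ] A →ₗ[ℂ] A)
      (Gr.neg g) (Gr.neg g) ≤ Gr.neg g := by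
    conv_lhs => simp only [neg, Submodule.map₂_iSup_left, Submodule.map₂_iSup_right]
    refine iSup₂_le fun l _ => iSup₂_le fun k hk => Submodule.map₂_le.2 fun x hx y hy => ?_
    have mul_mem : x * y ∈ Gr.E (k + l) := Gr.mul_mem k l x hx.1 y hy.1
    have mul_mem' : y * x ∈ Gr.E (k + l) := add_comm k l ▸ Gr.mul_mem l k y hy.1 x hx.1
    exact inf_le_neg (hk.trans (k.le_add_right l))
      ⟨sub_mem mul_mem mul_mem', g.lie_mem hx.2 hy.2⟩
  exact Submodule.map₂_le.1 map₂_le x hx y hy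

variable [FiniteDimensional ℂ A]

theorem exp_sub_one_mem_tail (hx : x ∈ Gr.tail 1) : exp x - 1 ∈ Gr.tail 1 := by
  refine mem_of_hasSum ((exp_hasSum x).sub (hasSum_ite_eq 0 (1 : A))) fun k => ?_
  rcases k.eq_zero_or_pos with rfl | hk
  · simp
  · rw [if_neg hk.ne', sub_zero]
    exact Submodule.smul_mem _ _ (tail_antitone hk (pow_mem_tail hx k))

theorem exp_add_sub_mem_tail (hm : 1 ≤ m) (hx : x ∈ Gr.tail 1) (hy : y ∈ Gr.tail m) :
    exp (x + y) - exp x - y ∈ Gr.tail (m + 1) := by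
  have hxy : x + y ∈ Gr.tail 1 := add_mem hx (tail_antitone hm hy)
  have pow_sub_pow_mem (k : ℕ) : (x + y) ^ (k + 1) - x ^ (k + 1) ∈ Gr.tail (m + k) := by
    induction k with
    | zero => simpa using hy
    | succ k ih =>
      have split : (x + y) ^ (k + 2) - x ^ (k + 2) =
          ((x + y) ^ (k + 1) - x ^ (k + 1)) * (x + y) + x ^ (k + 1) * y := by
        rw [pow_succ (x + y) (k + 1), pow_succ x (k + 1)]
        noncomm_ring
      rw [split]
      exact add_mem (add_assoc m k 1 ▸ mul_mem_tail ih hxy)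
        (add_comm (k + 1) m ▸ mul_mem_tail (pow_mem_tail hx (k + 1)) hy)
  refine mem_of_hasSum
    (((exp_hasSum (x + y)).sub (exp_hasSum x)).sub (hasSum_ite_eq 1 y)) fun k => ?_
  rcases k with _ | _ | k
  · simp
  · simp
  · rw [if_neg (by lia), sub_zero, ← smul_sub]
    exact Submodule.smul_mem _ _ (tail_antitone (by lia) (pow_sub_pow_mem (k + 1)))

theorem exp_sub_exp_trunc_sub_mem_tail (hx : x ∈ Gr.tail 1) (hk : 1 ≤ k) :
    exp x - exp (Gr.trunc k x) - (x - Gr.trunc k x) ∈ Gr.tail (k + 1) := by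
  have rest_mem := sub_trunc_mem_tail hx hk
  have trunc_mem : Gr.trunc k x ∈ Gr.tail 1 := by
    simpa using sub_mem hx (tail_antitone hk rest_mem)
  simpa using exp_add_sub_mem_tail hk trunc_mem rest_mem

theorem exp_sub_exp_trunc_mem_tail (hx : x ∈ Gr.tail 1) (hk : 1 ≤ k) :
    exp x - exp (Gr.trunc k x) ∈ Gr.tail k := by
  simpa using add_mem (tail_antitone k.le_succ (exp_sub_exp_trunc_sub_mem_tail hx hk))
    (sub_trunc_mem_tail hx hk)

theorem proj_exp_sub_exp_trunc (hx : x ∈ Gr.tail 1) (hk : 1 ≤ k) :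
    Gr.proj k (exp x - exp (Gr.trunc k x)) = Gr.proj k x := by
  rw [proj_eq_of_sub_mem_tail (exp_sub_exp_trunc_sub_mem_tail hx hk), map_sub, proj_trunc, sub_zero]

theorem exp_neg_mul_mul_exp_mem_neg (hx : x ∈ Gr.neg g) (hy : y ∈ Gr.neg g) :
    exp (-x) * y * exp x ∈ Gr.neg g := by
  rw [← exp_neg_adjointOp_apply]
  refine mem_of_hasSum ((exp_hasSum (-adjointOp x)).mapL (ContinuousLinearMap.apply ℂ A y))
    fun k => Submodule.smul_mem _ _ ?_
  induction k with
  | zero => exact hy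
  | succ k ih =>
    rw [pow_succ']
    exact neg_mem (lie_mem_neg hx ih)

theorem exp_neg_mul_fderiv_exp_mem_neg (hx : x ∈ Gr.neg g) (hy : y ∈ Gr.neg g) :
    exp (-x) * fderiv ℂ exp x y ∈ Gr.neg g :=
  exp_neg_mul_fderiv_exp_mem fun t =>
    exp_neg_mul_mul_exp_mem_neg (Submodule.smul_of_tower_mem _ t hx) hy

end LowerGrading

/-! ### Logarithmic connections on the polydisk -/

section EulerDeriv

open Set

variable {n : ℕ} {r : ℝ} {s : Fin n → ℂ} {U : Set (Fin n → ℂ)}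

section NormedSpace

variable {E : Type*} [NormedAddCommGroup E] [NormedSpace ℂ E] {f g : (Fin n → ℂ) → E}

theorem differentiableAt_of_mem_polydisk (hf : DifferentiableOn ℂ f (polydisk n r))
    (hs : s ∈ polydisk n r) : DifferentiableAt ℂ f s :=
  hf.differentiableAt (isOpen_polydisk.mem_nhds hs)

theorem eulerDeriv_congr (hU : IsOpen U) (hs : s ∈ U) (h : EqOn f g U) (j : Fin n) :
    eulerDeriv j f s = eulerDeriv j g s := by
  rw [eulerDeriv, eulerDeriv, pderiv, pderiv, (h.eventuallyEq_of_mem (hU.mem_nhds hs)).fderiv_eq]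

theorem eulerDeriv_add (hf : DifferentiableAt ℂ f s) (hg : DifferentiableAt ℂ g s) (j : Fin n) :
    eulerDeriv j (fun s => f s + g s) s = eulerDeriv j f s + eulerDeriv j g s := by
  simp [eulerDeriv, pderiv, fderiv_fun_add hf hg]

theorem eulerDeriv_sub (hf : DifferentiableAt ℂ f s) (hg : DifferentiableAt ℂ g s) (j : Fin n) :
    eulerDeriv j (fun s => f s - g s) s = eulerDeriv j f s - eulerDeriv j g s := by
  simp [eulerDeriv, pderiv, fderiv_fun_sub hf hg, smul_sub]

theorem eulerDeriv_const (a : E) (j : Fin n) : eulerDeriv j (fun _ => a) s = 0 := by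
  simp [eulerDeriv, pderiv]

theorem eulerDeriv_comp {F : Type*} [NormedAddCommGroup F] [NormedSpace ℂ F] {φ : E → F}
    (hφ : DifferentiableAt ℂ φ (f s)) (hf : DifferentiableAt ℂ f s) (j : Fin n) :
    eulerDeriv j (fun s => φ (f s)) s = fderiv ℂ φ (f s) (eulerDeriv j f s) := by
  simp [eulerDeriv, pderiv, fderiv_fun_comp s hφ hf]

theorem eulerDeriv_clm (p : E →L[ℂ] E) (hf : DifferentiableAt ℂ f s) (j : Fin n) :
    eulerDeriv j (fun s => p (f s)) s = p (eulerDeriv j f s) := by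
  rw [eulerDeriv_comp p.differentiableAt hf, p.fderiv]

variable [FiniteDimensional ℂ E]

theorem differentiableOn_eulerDeriv (hf : DifferentiableOn ℂ f (polydisk n r)) (j : Fin n) :
    DifferentiableOn ℂ (eulerDeriv j f) (polydisk n r) :=
  DifferentiableOn.smul (by fun_prop) (differentiableOn_fderiv_apply isOpen_polydisk hf _)

theorem eulerDeriv_eulerDeriv_of_ne (hf : DifferentiableOn ℂ f (polydisk n r))
    (hs : s ∈ polydisk n r) {i j : Fin n} (hij : i ≠ j) :
    eulerDeriv i (eulerDeriv j f) s = (s i * s j) • pderiv i (pderiv j f) s := by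
  have pderiv_differentiableAt : DifferentiableAt ℂ (pderiv j f) s :=
    differentiableAt_of_mem_polydisk (differentiableOn_fderiv_apply isOpen_polydisk hf _) hs
  have coord_hasFDerivAt : HasFDerivAt (fun s : Fin n → ℂ => s j)
      (ContinuousLinearMap.proj (R := ℂ) (φ := fun _ : Fin n => ℂ) j) s := hasFDerivAt_apply j s
  change s i • fderiv ℂ (fun s => s j • pderiv j f s) s (Pi.single i 1) = _
  rw [(coord_hasFDerivAt.fun_smul pderiv_differentiableAt.hasFDerivAt).fderiv]
  simp [hij.symm, smul_smul, pderiv]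

theorem eulerDeriv_comm (hf : DifferentiableOn ℂ f (polydisk n r)) (hs : s ∈ polydisk n r)
    (i j : Fin n) : eulerDeriv i (eulerDeriv j f) s = eulerDeriv j (eulerDeriv i f) s := by
  rcases eq_or_ne i j with rfl | hij
  · rfl
  rw [eulerDeriv_eulerDeriv_of_ne hf hs hij, eulerDeriv_eulerDeriv_of_ne hf hs hij.symm, mul_comm]
  congr 1
  exact fderiv_fderiv_comm isOpen_polydisk hf hs _ _

theorem eulerDeriv_mem {Q : Submodule ℂ E} (hU : IsOpen U) (hs : s ∈ U)
    (hf : DifferentiableAt ℂ f s) (h : ∀ s ∈ U, f s ∈ Q) (j : Fin n) : eulerDeriv j f s ∈ Q := by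
  obtain ⟨p, rfl⟩ := exists_clm_ker_eq Q
  change p _ = 0
  rw [← eulerDeriv_clm p hf, ← eulerDeriv_const (0 : E) j]
  exact eulerDeriv_congr hU hs h j

theorem mem_of_eulerDeriv_mem {Q : Submodule ℂ E} (hf : DifferentiableOn ℂ f (polydisk n r))
    (hf₀ : f 0 ∈ Q) (h : ∀ s ∈ puncturedPolydisk n r, ∀ j, eulerDeriv j f s ∈ Q)
    (hs : s ∈ polydisk n r) : f s ∈ Q := by
  obtain ⟨p, rfl⟩ := exists_clm_ker_eq Q
  have eulerDeriv_eq_zero : ∀ s ∈ puncturedPolydisk n r, ∀ j,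
      eulerDeriv j (fun s => p (f s)) s = 0 := fun s hs j =>
    (eulerDeriv_clm p (differentiableAt_of_mem_polydisk hf hs.1) j).trans (h s hs j)
  exact (eqOn_of_eulerDeriv_eq_zero (p.differentiable.comp_differentiableOn hf)
    eulerDeriv_eq_zero hs).trans hf₀

theorem eqOn_of_eulerDeriv_eq (hf : DifferentiableOn ℂ f (polydisk n r))
    (hg : DifferentiableOn ℂ g (polydisk n r)) (h₀ : f 0 = g 0)
    (h : ∀ s ∈ puncturedPolydisk n r, ∀ j, eulerDeriv j f s = eulerDeriv j g s) :
    EqOn f g (polydisk n r) := fun s hs => by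
  have eulerDeriv_sub_eq_zero : ∀ s ∈ puncturedPolydisk n r, ∀ j,
      eulerDeriv j (fun s => f s - g s) s = 0 := fun s hs j => by
    rw [eulerDeriv_sub (differentiableAt_of_mem_polydisk hf hs.1)
      (differentiableAt_of_mem_polydisk hg hs.1), h s hs j, sub_self]
  exact sub_eq_zero.1 <| (eqOn_of_eulerDeriv_eq_zero (hf.fun_sub hg) eulerDeriv_sub_eq_zero
    hs).trans (sub_eq_zero.2 h₀)

end NormedSpace

variable {A : Type*} [NormedRing A] [NormedAlgebra ℂ A] {f g : (Fin n → ℂ) → A}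

theorem eulerDeriv_mul (hf : DifferentiableAt ℂ f s) (hg : DifferentiableAt ℂ g s) (j : Fin n) :
    eulerDeriv j (fun s => f s * g s) s = eulerDeriv j f s * g s + f s * eulerDeriv j g s := by
  simp [eulerDeriv, pderiv, fderiv_fun_mul' hf hg, add_comm]

theorem eulerDeriv_const_mul (a : A) (hf : DifferentiableAt ℂ f s) (j : Fin n) :
    eulerDeriv j (fun s => a * f s) s = a * eulerDeriv j f s := by
  rw [eulerDeriv_mul (differentiableAt_const a) hf, eulerDeriv_const, zero_mul, zero_add]

theorem differentiableOn_exp [CompleteSpace A] (hf : DifferentiableOn ℂ f U) :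
    DifferentiableOn ℂ (fun s => exp (f s)) U :=
  differentiable_exp.comp_differentiableOn hf

end EulerDeriv

section LogConnection

variable {n : ℕ} {r : ℝ} {A : Type*} [NormedRing A] [NormedAlgebra ℂ A] {M : Fin n → A}
  {h : Fin n → (Fin n → ℂ) → A} {G u v : (Fin n → ℂ) → A} {s : Fin n → ℂ}

/-- The coefficient of `ds_j / s_j` in the covariant derivative of `u`, as a homomorphism from the
trivial bundle with connection `d + ∑ h_j ds_j / s_j` to the one with `d + ∑ M_j ds_j / s_j`. -/
def homDeriv (M : Fin n → A) (h : Fin n → (Fin n → ℂ) → A) (j : Fin n) (u : (Fin n → ℂ) → A)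
    (s : Fin n → ℂ) : A :=
  eulerDeriv j u s + M j * u s - u s * h j s

/-- The coefficient of `ds_j / s_j` in `e^{-G} (∂ + ∑ M_j ds_j / s_j) e^G`. -/
def logForm (M : Fin n → A) (G : (Fin n → ℂ) → A) (j : Fin n) (s : Fin n → ℂ) : A :=
  exp (-(G s)) * (eulerDeriv j (fun s => exp (G s)) s + M j * exp (G s))

/-- The coefficient of `ds_j / s_j` in `∑ M_j ds_j / s_j + ∂γ`. -/
def higgsForm (M : Fin n → A) (γ : (Fin n → ℂ) → A) (j : Fin n) (s : Fin n → ℂ) : A :=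
  M j + eulerDeriv j γ s

theorem homDeriv_sub (hu : DifferentiableAt ℂ u s) (hv : DifferentiableAt ℂ v s) (j : Fin n) :
    homDeriv M h j (fun s => u s - v s) s = homDeriv M h j u s - homDeriv M h j v s := by
  rw [homDeriv, homDeriv, homDeriv, eulerDeriv_sub hu hv]
  noncomm_ring

theorem logForm_zero (j : Fin n) : logForm M 0 j s = M j := by
  simp [logForm, eulerDeriv_const]

theorem logForm_congr {G' : (Fin n → ℂ) → A} (hG : Set.EqOn G G' (polydisk n r))
    (hs : s ∈ polydisk n r) (j : Fin n) : logForm M G j s = logForm M G' j s := by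
  rw [logForm, logForm, hG hs,
    eulerDeriv_congr isOpen_polydisk hs fun s hs => congrArg exp (hG hs)]

variable [FiniteDimensional ℂ A]

theorem differentiableOn_homDeriv (hu : DifferentiableOn ℂ u (polydisk n r))
    (hh : ∀ j, DifferentiableOn ℂ (h j) (polydisk n r)) (j : Fin n) :
    DifferentiableOn ℂ (homDeriv M h j u) (polydisk n r) :=
  ((differentiableOn_eulerDeriv hu j).fun_add (hu.const_mul (M j))).fun_sub (hu.fun_mul (hh j))

/-- When the form `∑ h_j ds_j / s_j` is closed, the curvature of the connection on homomorphisms is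
the commutator of its coefficients. -/
theorem homDeriv_homDeriv_sub (hM : ∀ i j, Commute (M i) (M j))
    (hu : DifferentiableOn ℂ u (polydisk n r)) (hh : ∀ j, DifferentiableOn ℂ (h j) (polydisk n r))
    (hs : s ∈ polydisk n r) {i j : Fin n} (hclosed : eulerDeriv i (h j) s = eulerDeriv j (h i) s) :
    homDeriv M h i (homDeriv M h j u) s - homDeriv M h j (homDeriv M h i u) s =
      u s * ⁅h j s, h i s⁆ := by
  have hus := differentiableAt_of_mem_polydisk hu hs
  have expand (i j : Fin n) : eulerDeriv i (homDeriv M h j u) s =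
      eulerDeriv i (eulerDeriv j u) s + M j * eulerDeriv i u s -
        (eulerDeriv i u s * h j s + u s * eulerDeriv i (h j) s) := by
    have hhs := differentiableAt_of_mem_polydisk (hh j) hs
    have hθ := differentiableAt_of_mem_polydisk (differentiableOn_eulerDeriv hu j) hs
    rw [← eulerDeriv_mul hus hhs, ← eulerDeriv_const_mul _ hus,
      ← eulerDeriv_add hθ (hus.const_mul (M j)),
      ← eulerDeriv_sub (hθ.fun_add (hus.const_mul (M j))) (hus.fun_mul hhs)]
    rfl
  simp only [homDeriv] at expand ⊢
  rw [expand i j, expand j i, eulerDeriv_comm hu hs i j, hclosed, Ring.lie_def, ← sub_eq_zero]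
  calc _ = (M i * M j - M j * M i) * u s := by noncomm_ring
    _ = 0 := by rw [(hM i j).eq, sub_self, zero_mul]

theorem commute_of_homDeriv_eq_zero (hM : ∀ i j, Commute (M i) (M j))
    (hu : DifferentiableOn ℂ u (polydisk n r)) (hh : ∀ j, DifferentiableOn ℂ (h j) (polydisk n r))
    (hflat : ∀ s ∈ puncturedPolydisk n r, ∀ j, homDeriv M h j u s = 0)
    (hs : s ∈ puncturedPolydisk n r) {a : A} (ha : a * u s = 1) {i j : Fin n}
    (hclosed : eulerDeriv i (h j) s = eulerDeriv j (h i) s) : Commute (h i s) (h j s) := by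
  have homDeriv_homDeriv (i j : Fin n) : homDeriv M h i (homDeriv M h j u) s = 0 := by
    rw [homDeriv, eulerDeriv_congr isOpen_puncturedPolydisk hs (g := fun _ => 0)
      fun s hs => hflat s hs j, eulerDeriv_const, hflat s hs j]
    noncomm_ring
  have mul_lie_eq_zero := homDeriv_homDeriv_sub hM hu hh hs.1 hclosed
  rw [homDeriv_homDeriv, homDeriv_homDeriv, sub_zero] at mul_lie_eq_zero
  have lie_eq_zero : ⁅h j s, h i s⁆ = 0 := by
    rw [← one_mul ⁅h j s, h i s⁆, ← ha, mul_assoc, ← mul_lie_eq_zero, mul_zero]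
  exact (sub_eq_zero.1 lie_eq_zero).symm

theorem exp_neg_mul_homDeriv_exp (j : Fin n) :
    exp (-(G s)) * homDeriv M h j (fun s => exp (G s)) s = logForm M G j s - h j s := by
  rw [homDeriv, logForm, mul_sub, ← mul_assoc _ _ (h j s), exp_neg_mul_exp, one_mul]

theorem homDeriv_exp_eq_zero_iff {j : Fin n} :
    homDeriv M h j (fun s => exp (G s)) s = 0 ↔ logForm M G j s = h j s := by
  rw [← sub_eq_zero (b := h j s), ← exp_neg_mul_homDeriv_exp]
  refine ⟨fun hflat => by rw [hflat, mul_zero], fun hzero => ?_⟩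
  rw [← one_mul (homDeriv M h j _ s), ← exp_mul_exp_neg (G s), mul_assoc, hzero, mul_zero]

theorem differentiableOn_higgsForm {γ : (Fin n → ℂ) → A}
    (hγ : DifferentiableOn ℂ γ (polydisk n r)) (j : Fin n) :
    DifferentiableOn ℂ (higgsForm M γ j) (polydisk n r) :=
  (differentiableOn_const (M j)).add (differentiableOn_eulerDeriv hγ j)

theorem eulerDeriv_higgsForm_comm {γ : (Fin n → ℂ) → A}
    (hγ : DifferentiableOn ℂ γ (polydisk n r)) (hs : s ∈ polydisk n r) (i j : Fin n) :
    eulerDeriv i (higgsForm M γ j) s = eulerDeriv j (higgsForm M γ i) s := by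
  have eulerDeriv_higgsForm (i j : Fin n) :
      eulerDeriv i (higgsForm M γ j) s = eulerDeriv i (eulerDeriv j γ) s := by
    rw [← zero_add (eulerDeriv i (eulerDeriv j γ) s), ← eulerDeriv_const (M j) i]
    exact eulerDeriv_add (differentiableAt_const _)
      (differentiableAt_of_mem_polydisk (differentiableOn_eulerDeriv hγ j) hs) i
  rw [eulerDeriv_higgsForm, eulerDeriv_higgsForm, eulerDeriv_comm hγ hs]

variable {Gr : LowerGrading A} {g : LieSubalgebra ℂ A}

theorem logForm_mem_neg (hM : ∀ j, M j ∈ Gr.neg g) (hG : DifferentiableOn ℂ G (polydisk n r))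
    (hG_mem : ∀ s ∈ polydisk n r, G s ∈ Gr.neg g) (hs : s ∈ polydisk n r) (j : Fin n) :
    logForm M G j s ∈ Gr.neg g := by
  have hGs := differentiableAt_of_mem_polydisk hG hs
  rw [logForm, mul_add, eulerDeriv_comp (differentiable_exp _) hGs, ← mul_assoc]
  exact add_mem
    (LowerGrading.exp_neg_mul_fderiv_exp_mem_neg (hG_mem s hs)
      (eulerDeriv_mem isOpen_polydisk hs hGs hG_mem j))
    (LowerGrading.exp_neg_mul_mul_exp_mem_neg (hG_mem s hs) (hM j))

/-- If a flat homomorphism `u` agrees with `e^G` below degree `k`, then the degree `k` parts of `u`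
and of the connection forms are related as if the algebra were commutative. -/
theorem eulerDeriv_proj_sub_exp {k : ℕ} (hM : ∀ j, M j ∈ Gr.tail 1)
    (hu : DifferentiableOn ℂ u (polydisk n r)) (hG : DifferentiableOn ℂ G (polydisk n r))
    (huG : ∀ s ∈ polydisk n r, u s - exp (G s) ∈ Gr.tail k) (hs : s ∈ polydisk n r)
    (hGs : G s ∈ Gr.tail 1) {j : Fin n} (hh : h j s ∈ Gr.tail 1)
    (hflat : homDeriv M h j u s = 0) :
    eulerDeriv j (fun s => Gr.proj k (u s - exp (G s))) s =
      Gr.proj k (h j s) - Gr.proj k (logForm M G j s) := by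
  set δ : (Fin n → ℂ) → A := fun s => u s - exp (G s)
  have hexp := differentiableOn_exp hG
  have hδ := differentiableAt_of_mem_polydisk (hu.fun_sub hexp) hs
  have form_diff : h j s - logForm M G j s = exp (-(G s)) * homDeriv M h j δ s := by
    rw [homDeriv_sub (differentiableAt_of_mem_polydisk hu hs)
      (differentiableAt_of_mem_polydisk hexp hs), hflat, zero_sub, mul_neg,
      exp_neg_mul_homDeriv_exp, neg_sub]
  have θδ_mem : eulerDeriv j δ s ∈ Gr.tail k := eulerDeriv_mem isOpen_polydisk hs hδ huG j
  have homDeriv_sub_mem : homDeriv M h j δ s - eulerDeriv j δ s ∈ Gr.tail (k + 1) := by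
    have := sub_mem (add_comm 1 k ▸ LowerGrading.mul_mem_tail (hM j) (huG s hs))
      (LowerGrading.mul_mem_tail (huG s hs) hh)
    rwa [homDeriv, add_sub_assoc, add_sub_cancel_left]
  have homDeriv_mem : homDeriv M h j δ s ∈ Gr.tail k := by
    simpa using add_mem (LowerGrading.tail_antitone k.le_succ homDeriv_sub_mem) θδ_mem
  have exp_mul_sub_mem : (exp (-(G s)) - 1) * homDeriv M h j δ s ∈ Gr.tail (k + 1) :=
    add_comm 1 k ▸ LowerGrading.mul_mem_tail
      (LowerGrading.exp_sub_one_mem_tail (neg_mem hGs)) homDeriv_mem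
  rw [eulerDeriv_clm _ hδ, ← map_sub, form_diff]
  refine (LowerGrading.proj_eq_of_sub_mem_tail ?_).symm
  simpa [sub_mul] using add_mem exp_mul_sub_mem homDeriv_sub_mem

end LogConnection

/-! ### Solutions of a graded logarithmic connection -/

/-- A logarithmic connection `d + ∑ M_j ds_j / s_j` with commuting constant coefficients of degree
one in a Lie subalgebra `g` of a graded algebra. -/
structure GradedLogConnection (A : Type*) [NormedRing A] [NormedAlgebra ℂ A] (n : ℕ) extends
    LowerGrading A where
  g : LieSubalgebra ℂ A
  M : Fin n → A
  M_mem : ∀ j, M j ∈ E 1 ⊓ g.toSubmodule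
  M_comm : ∀ i j, Commute (M i) (M j)

namespace GradedLogConnection

open Set

variable {A : Type*} [NormedRing A] [NormedAlgebra ℂ A] {n : ℕ} (C : GradedLogConnection A n)
  (r : ℝ)

/-- A holomorphic gauge transformation `e^G` of the polydisk, trivial at the origin, with `G` of
positive degree in `g`. -/
structure IsGauge (G : (Fin n → ℂ) → A) : Prop where
  differentiableOn : DifferentiableOn ℂ G (polydisk n r)
  map_zero : G 0 = 0
  mem_neg : ∀ s ∈ polydisk n r, G s ∈ C.neg C.g

/-- The abstract form of (6.10): the gauge transformation `e^Γ` turns the connection into one with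
coefficients of degree one. -/
structure IsSolution (Γ : (Fin n → ℂ) → A) : Prop extends C.IsGauge r Γ where
  logForm_mem : ∀ s ∈ puncturedPolydisk n r, ∀ j, logForm C.M Γ j s ∈ C.E 1

/-- The abstract form of the integrability condition on `Γ_{-1}`: the coefficients of
`∂X_{-1} = ∑ M_j ds_j / s_j + ∂γ` commute. -/
structure IsHiggsPotential (γ : (Fin n → ℂ) → A) : Prop where
  differentiableOn : DifferentiableOn ℂ γ (polydisk n r)
  map_zero : γ 0 = 0
  mem : ∀ s ∈ polydisk n r, γ s ∈ C.E 1 ⊓ C.g.toSubmodule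
  commute : ∀ s ∈ puncturedPolydisk n r, ∀ i j,
    Commute (higgsForm C.M γ i s) (higgsForm C.M γ j s)

/-- A unipotent approximation in degrees at most `k` of a flat homomorphism from `d + ∂X_{-1}` to
`d + ∑ M_j ds_j / s_j`. -/
structure IsApproxFlat (γ : (Fin n → ℂ) → A) (k : ℕ) (u : (Fin n → ℂ) → A) : Prop where
  differentiableOn : DifferentiableOn ℂ u (polydisk n r)
  map_zero : u 0 = 1
  sub_one_mem : ∀ s ∈ polydisk n r, u s - 1 ∈ C.tail 1
  homDeriv_mem : ∀ s ∈ puncturedPolydisk n r, ∀ j,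
    homDeriv C.M (higgsForm C.M γ) j u s ∈ C.E (k + 1)

variable {C} {r} {G Γ Γ' γ u : (Fin n → ℂ) → A} {s : Fin n → ℂ} {k : ℕ}

theorem M_mem_neg (j : Fin n) : C.M j ∈ C.neg C.g := LowerGrading.inf_le_neg le_rfl (C.M_mem j)

theorem mul_sub_mul_mem {x y : A} (hx : x ∈ C.E k) (hy : y ∈ C.E 1) (j : Fin n) :
    C.M j * x - x * y ∈ C.E (k + 1) :=
  sub_mem (add_comm 1 k ▸ C.mul_mem 1 k _ (C.M_mem j).1 _ hx) (C.mul_mem k 1 _ hx _ hy)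

theorem IsGauge.mem_tail (hG : C.IsGauge r G) (hs : s ∈ polydisk n r) : G s ∈ C.tail 1 :=
  LowerGrading.neg_le_tail (hG.mem_neg s hs)

theorem IsGauge.differentiableOn_proj (hG : C.IsGauge r G) (k : ℕ) :
    DifferentiableOn ℂ (fun s => C.proj k (G s)) (polydisk n r) :=
  (C.proj k).differentiable.comp_differentiableOn hG.differentiableOn

theorem IsGauge.trunc (hG : C.IsGauge r G) (k : ℕ) :
    C.IsGauge r fun s => C.trunc k (G s) where
  differentiableOn := (C.trunc k).differentiable.comp_differentiableOn hG.differentiableOn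
  map_zero := by rw [hG.map_zero, _root_.map_zero]
  mem_neg s hs := LowerGrading.trunc_mem_neg (hG.mem_neg s hs) k

theorem IsSolution.congr (hr : 0 < r) (hΓ : C.IsSolution r Γ) (h : EqOn Γ' Γ (polydisk n r)) :
    C.IsSolution r Γ' where
  differentiableOn := hΓ.differentiableOn.congr h
  map_zero := (h (zero_mem_polydisk hr)).trans hΓ.map_zero
  mem_neg s hs := h hs ▸ hΓ.mem_neg s hs
  logForm_mem s hs j := logForm_congr h hs.1 j ▸ hΓ.logForm_mem s hs j

variable [FiniteDimensional ℂ A]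

namespace IsGauge

theorem logForm_mem_neg (hG : C.IsGauge r G) (hs : s ∈ polydisk n r) (j : Fin n) :
    logForm C.M G j s ∈ C.neg C.g :=
  LimitHodge.logForm_mem_neg M_mem_neg hG.differentiableOn hG.mem_neg hs j

theorem eulerDeriv_proj (hG : C.IsGauge r G) (hk : 1 ≤ k) (hs : s ∈ polydisk n r) (j : Fin n) :
    eulerDeriv j (fun s => C.proj k (G s)) s =
      C.proj k (logForm C.M G j s) - C.proj k (logForm C.M (fun s => C.trunc k (G s)) j s) := by
  rw [← eulerDeriv_proj_sub_exp (fun j => LowerGrading.neg_le_tail (M_mem_neg j))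
    (differentiableOn_exp hG.differentiableOn) (G := fun s => C.trunc k (G s))
    (hG.trunc k).differentiableOn
    (fun s hs => LowerGrading.exp_sub_exp_trunc_mem_tail (hG.mem_tail hs) hk) hs
    ((hG.trunc k).mem_tail hs)
    (LowerGrading.neg_le_tail (hG.logForm_mem_neg hs j)) (homDeriv_exp_eq_zero_iff.2 rfl)]
  exact eulerDeriv_congr isOpen_polydisk hs
    (fun s hs => (LowerGrading.proj_exp_sub_exp_trunc (hG.mem_tail hs) hk).symm) j

end IsGauge

namespace IsSolution

theorem logForm_eq_higgsForm (hΓ : C.IsSolution r Γ) (hs : s ∈ puncturedPolydisk n r)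
    (j : Fin n) : logForm C.M Γ j s = higgsForm C.M (fun s => C.proj 1 (Γ s)) j s := by
  have trunc_eq_zero : (fun s => C.trunc 1 (Γ s)) = 0 := funext fun _ => LowerGrading.trunc_one
  rw [higgsForm, hΓ.eulerDeriv_proj le_rfl hs.1, trunc_eq_zero, logForm_zero,
    C.proj_same 1 _ (hΓ.logForm_mem s hs j), C.proj_same 1 _ (C.M_mem j).1, add_sub_cancel]

theorem homDeriv_exp (hΓ : C.IsSolution r Γ) (hs : s ∈ puncturedPolydisk n r) (j : Fin n) :
    homDeriv C.M (higgsForm C.M fun s => C.proj 1 (Γ s)) j (fun s => exp (Γ s)) s = 0 :=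
  homDeriv_exp_eq_zero_iff.2 (hΓ.logForm_eq_higgsForm hs j)

theorem eulerDeriv_proj_of_two_le (hΓ : C.IsSolution r Γ) (hk : 2 ≤ k)
    (hs : s ∈ puncturedPolydisk n r) (j : Fin n) :
    eulerDeriv j (fun s => C.proj k (Γ s)) s =
      -C.proj k (logForm C.M (fun s => C.trunc k (Γ s)) j s) := by
  rw [hΓ.eulerDeriv_proj (by lia) hs.1, C.proj_other k 1 (by lia) _ (hΓ.logForm_mem s hs j),
    zero_sub]

theorem isHiggsPotential (hΓ : C.IsSolution r Γ) :
    C.IsHiggsPotential r fun s => C.proj 1 (Γ s) where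
  differentiableOn := hΓ.differentiableOn_proj 1
  map_zero := by rw [hΓ.map_zero, map_zero]
  mem s hs := LowerGrading.proj_mem_of_mem_neg (hΓ.mem_neg s hs) 1
  commute s hs _ _ := commute_of_homDeriv_eq_zero C.M_comm
    (differentiableOn_exp hΓ.differentiableOn)
    (differentiableOn_higgsForm (hΓ.differentiableOn_proj 1)) (fun _ hs j => hΓ.homDeriv_exp hs j)
    hs (exp_neg_mul_exp (Γ s)) (eulerDeriv_higgsForm_comm (hΓ.differentiableOn_proj 1) hs.1 _ _)

theorem eqOn_proj_of_eqOn_trunc (hΓ : C.IsSolution r Γ) (hΓ' : C.IsSolution r Γ') (hk : 2 ≤ k)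
    (h : EqOn (fun s => C.trunc k (Γ s)) (fun s => C.trunc k (Γ' s)) (polydisk n r)) :
    EqOn (fun s => C.proj k (Γ s)) (fun s => C.proj k (Γ' s)) (polydisk n r) := by
  refine eqOn_of_eulerDeriv_eq (hΓ.differentiableOn_proj k) (hΓ'.differentiableOn_proj k)
    (by rw [hΓ.map_zero, hΓ'.map_zero]) fun s hs j => ?_
  rw [hΓ.eulerDeriv_proj_of_two_le hk hs, hΓ'.eulerDeriv_proj_of_two_le hk hs,
    logForm_congr h hs.1]

theorem eqOn_of_eqOn_proj_one (hΓ : C.IsSolution r Γ) (hΓ' : C.IsSolution r Γ')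
    (h : EqOn (fun s => C.proj 1 (Γ s)) (fun s => C.proj 1 (Γ' s)) (polydisk n r)) :
    EqOn Γ Γ' (polydisk n r) := by
  have trunc_eqOn (k : ℕ) :
      EqOn (fun s => C.trunc (k + 1) (Γ s)) (fun s => C.trunc (k + 1) (Γ' s)) (polydisk n r) := by
    induction k with
    | zero => exact fun s _ => LowerGrading.trunc_one.trans LowerGrading.trunc_one.symm
    | succ k ih =>
      have proj_eqOn : EqOn (fun s => C.proj (k + 1) (Γ s)) (fun s => C.proj (k + 1) (Γ' s))
          (polydisk n r) := by
        rcases k.eq_zero_or_pos with rfl | hk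
        · exact h
        · exact hΓ.eqOn_proj_of_eqOn_trunc hΓ' (by lia) ih
      intro s hs
      simp only [LowerGrading.trunc_succ k.succ_pos]
      exact congrArg₂ (· + ·) (ih hs) (proj_eqOn hs)
  obtain ⟨K, hK⟩ := C.exists_trunc_eq
  intro s hs
  have mem_tail : Γ s ∈ C.tail 1 := hΓ.mem_tail hs
  have mem_tail' : Γ' s ∈ C.tail 1 := hΓ'.mem_tail hs
  rw [← hK _ mem_tail, ← hK _ mem_tail']
  rcases K with _ | K
  · simp [LowerGrading.trunc]
  · exact trunc_eqOn K hs

end IsSolution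

namespace IsHiggsPotential

theorem higgsForm_mem (hγ : C.IsHiggsPotential r γ) (hs : s ∈ polydisk n r) (j : Fin n) :
    higgsForm C.M γ j s ∈ C.E 1 ⊓ C.g.toSubmodule :=
  add_mem (C.M_mem j) (eulerDeriv_mem isOpen_polydisk hs
    (differentiableAt_of_mem_polydisk hγ.differentiableOn hs) hγ.mem j)

theorem isApproxFlat_one (hγ : C.IsHiggsPotential r γ) : C.IsApproxFlat r γ 0 fun _ => 1 where
  differentiableOn := differentiableOn_const 1
  map_zero := rfl
  sub_one_mem _ _ := by simp
  homDeriv_mem s hs j := by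
    simpa [homDeriv, eulerDeriv_const] using
      mul_sub_mul_mem C.one_mem (hγ.higgsForm_mem hs.1 j).1 j

theorem proj_homDeriv (hγ : C.IsHiggsPotential r γ) (hu : DifferentiableOn ℂ u (polydisk n r))
    (hu_mem : ∀ s ∈ puncturedPolydisk n r, u s ∈ C.E k) (hs : s ∈ puncturedPolydisk n r)
    (j : Fin n) : C.proj k (homDeriv C.M (higgsForm C.M γ) j u s) = eulerDeriv j u s := by
  have eulerDeriv_u_mem : eulerDeriv j u s ∈ C.E k := eulerDeriv_mem isOpen_puncturedPolydisk hs
    (differentiableAt_of_mem_polydisk hu hs.1) hu_mem j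
  rw [homDeriv, add_sub_assoc, map_add, C.proj_same k _ eulerDeriv_u_mem,
    C.proj_other k (k + 1) (by lia) _
      (mul_sub_mul_mem (hu_mem s hs) (hγ.higgsForm_mem hs.1 j).1 j), add_zero]

theorem eulerDeriv_homDeriv_comm (hγ : C.IsHiggsPotential r γ) (hu : C.IsApproxFlat r γ k u)
    (hs : s ∈ puncturedPolydisk n r) (i j : Fin n) :
    eulerDeriv i (homDeriv C.M (higgsForm C.M γ) j u) s =
      eulerDeriv j (homDeriv C.M (higgsForm C.M γ) i u) s := by
  have hh := differentiableOn_higgsForm (M := C.M) hγ.differentiableOn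
  have curvature_eq_zero := homDeriv_homDeriv_sub C.M_comm hu.differentiableOn hh hs.1
    (eulerDeriv_higgsForm_comm hγ.differentiableOn hs.1 i j)
  rw [Ring.lie_def, (hγ.commute s hs j i).eq, sub_self, mul_zero, sub_eq_zero] at curvature_eq_zero
  have proj_homDeriv_homDeriv (i j : Fin n) := hγ.proj_homDeriv
    (differentiableOn_homDeriv hu.differentiableOn hh j) (fun s hs => hu.homDeriv_mem s hs j) hs i
  rw [← proj_homDeriv_homDeriv, curvature_eq_zero, proj_homDeriv_homDeriv]

theorem exists_isApproxFlat_succ (hγ : C.IsHiggsPotential r γ) (hu : C.IsApproxFlat r γ k u) :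
    ∃ v, C.IsApproxFlat r γ (k + 1) v := by
  obtain ⟨f, hf, hf₀, eulerDeriv_f⟩ := exists_log_primitive
    (differentiableOn_homDeriv hu.differentiableOn
      (differentiableOn_higgsForm (M := C.M) hγ.differentiableOn))
    (fun j => by simp [homDeriv, eulerDeriv, hu.map_zero, higgsForm])
    fun s hs i j => hγ.eulerDeriv_homDeriv_comm hu hs i j
  set e : (Fin n → ℂ) → A := fun s => C.proj (k + 1) (f s)
  have he : DifferentiableOn ℂ e (polydisk n r) :=
    (C.proj (k + 1)).differentiable.comp_differentiableOn hf
  have e_mem (s : Fin n → ℂ) : e s ∈ C.E (k + 1) := C.proj_mem (k + 1) (f s)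
  have eulerDeriv_e {s} (hs : s ∈ puncturedPolydisk n r) (j : Fin n) :
      eulerDeriv j e s = homDeriv C.M (higgsForm C.M γ) j u s := by
    rw [eulerDeriv_clm _ (differentiableAt_of_mem_polydisk hf hs.1), eulerDeriv_f s hs j,
      C.proj_same _ _ (hu.homDeriv_mem s hs j)]
  refine ⟨fun s => u s - e s, hu.differentiableOn.sub he, by simp [e, hu.map_zero, hf₀],
    fun s hs => ?_, fun s hs j => ?_⟩
  · rw [sub_right_comm]
    exact sub_mem (hu.sub_one_mem s hs) (LowerGrading.E_le_tail (by lia) (e_mem s))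
  · rw [homDeriv_sub (differentiableAt_of_mem_polydisk hu.differentiableOn hs.1)
      (differentiableAt_of_mem_polydisk he hs.1), homDeriv.eq_def _ _ _ e, eulerDeriv_e hs,
      add_sub_assoc, sub_add_cancel_left]
    exact neg_mem (mul_sub_mul_mem (e_mem s) (hγ.higgsForm_mem hs.1 j).1 j)

theorem exists_flat (hγ : C.IsHiggsPotential r γ) :
    ∃ u, DifferentiableOn ℂ u (polydisk n r) ∧ u 0 = 1 ∧
      (∀ s ∈ polydisk n r, u s - 1 ∈ C.tail 1) ∧
      ∀ s ∈ puncturedPolydisk n r, ∀ j, homDeriv C.M (higgsForm C.M γ) j u s = 0 := by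
  have exists_isApproxFlat (k : ℕ) : ∃ u, C.IsApproxFlat r γ k u := by
    induction k with
    | zero => exact ⟨_, hγ.isApproxFlat_one⟩
    | succ k ih => exact ih.elim fun _ => hγ.exists_isApproxFlat_succ
  obtain ⟨K, hK⟩ := C.exists_bound
  obtain ⟨u, hu⟩ := exists_isApproxFlat K
  refine ⟨u, hu.differentiableOn, hu.map_zero, hu.sub_one_mem, fun s hs j => ?_⟩
  have homDeriv_mem := hu.homDeriv_mem s hs j
  rwa [hK (K + 1) K.le_succ, Submodule.mem_bot] at homDeriv_mem

theorem proj_sub_exp_mem (hγ : C.IsHiggsPotential r γ)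
    (hu : DifferentiableOn ℂ u (polydisk n r)) (hu₀ : u 0 = 1)
    (hflat : ∀ s ∈ puncturedPolydisk n r, ∀ j, homDeriv C.M (higgsForm C.M γ) j u s = 0)
    (hG : C.IsGauge r G) (huG : ∀ s ∈ polydisk n r, u s - exp (G s) ∈ C.tail k)
    (hs : s ∈ polydisk n r) : C.proj k (u s - exp (G s)) ∈ C.g.toSubmodule := by
  refine mem_of_eulerDeriv_mem (f := fun s => C.proj k (u s - exp (G s)))
    ((C.proj k).differentiable.comp_differentiableOn
      (hu.sub (differentiableOn_exp hG.differentiableOn)))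
    (by simp [hu₀, hG.map_zero]) (fun s hs j => ?_) hs
  have higgsForm_mem_neg := LowerGrading.inf_le_neg le_rfl (hγ.higgsForm_mem hs.1 j)
  rw [eulerDeriv_proj_sub_exp (fun j => LowerGrading.neg_le_tail (M_mem_neg j)) hu
    hG.differentiableOn huG hs.1 (hG.mem_tail hs.1) (LowerGrading.neg_le_tail higgsForm_mem_neg)
    (hflat s hs j)]
  exact sub_mem (LowerGrading.proj_mem_of_mem_neg higgsForm_mem_neg k).2
    (LowerGrading.proj_mem_of_mem_neg (hG.logForm_mem_neg hs.1 j) k).2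

theorem exists_isGauge_succ (hγ : C.IsHiggsPotential r γ)
    (hu : DifferentiableOn ℂ u (polydisk n r)) (hu₀ : u 0 = 1)
    (hflat : ∀ s ∈ puncturedPolydisk n r, ∀ j, homDeriv C.M (higgsForm C.M γ) j u s = 0)
    (hG : C.IsGauge r G) (hk : 1 ≤ k) (huG : ∀ s ∈ polydisk n r, u s - exp (G s) ∈ C.tail k) :
    ∃ G', C.IsGauge r G' ∧ ∀ s ∈ polydisk n r, u s - exp (G' s) ∈ C.tail (k + 1) := by
  set x : (Fin n → ℂ) → A := fun s => C.proj k (u s - exp (G s))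
  have hx : DifferentiableOn ℂ x (polydisk n r) := (C.proj k).differentiable.comp_differentiableOn
    (hu.sub (differentiableOn_exp hG.differentiableOn))
  have x_mem (s : Fin n → ℂ) : x s ∈ C.E k := C.proj_mem k _
  refine ⟨fun s => G s + x s, ⟨hG.differentiableOn.add hx, by simp [x, hu₀, hG.map_zero],
    fun s hs => add_mem (hG.mem_neg s hs) (LowerGrading.inf_le_neg hk
      ⟨x_mem s, hγ.proj_sub_exp_mem hu hu₀ hflat hG huG hs⟩)⟩, fun s hs => ?_⟩
  have := sub_mem (LowerGrading.sub_proj_mem_tail (huG s hs))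
    (LowerGrading.exp_add_sub_mem_tail hk (hG.mem_tail hs)
      (LowerGrading.E_le_tail le_rfl (x_mem s)))
  rwa [sub_sub_sub_cancel_right, sub_sub_sub_cancel_right] at this

theorem exists_exp_eq (hγ : C.IsHiggsPotential r γ)
    (hu : DifferentiableOn ℂ u (polydisk n r)) (hu₀ : u 0 = 1)
    (hu₁ : ∀ s ∈ polydisk n r, u s - 1 ∈ C.tail 1)
    (hflat : ∀ s ∈ puncturedPolydisk n r, ∀ j, homDeriv C.M (higgsForm C.M γ) j u s = 0) :
    ∃ Γ, C.IsGauge r Γ ∧ ∀ s ∈ polydisk n r, u s = exp (Γ s) := by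
  have exists_isGauge (k : ℕ) (hk : 1 ≤ k) :
      ∃ G, C.IsGauge r G ∧ ∀ s ∈ polydisk n r, u s - exp (G s) ∈ C.tail k := by
    induction k, hk using Nat.le_induction with
    | base =>
      exact ⟨0, ⟨differentiableOn_const 0, rfl, fun _ _ => zero_mem _⟩,
        fun s hs => by simpa using hu₁ s hs⟩
    | succ k hk ih =>
      obtain ⟨G, hG, huG⟩ := ih
      exact hγ.exists_isGauge_succ hu hu₀ hflat hG hk huG
  obtain ⟨K, hK, tail_K⟩ := C.exists_tail_eq_bot
  obtain ⟨Γ, hΓ, huΓ⟩ := exists_isGauge K hK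
  refine ⟨Γ, hΓ, fun s hs => ?_⟩
  have sub_exp_mem := huΓ s hs
  rwa [tail_K, Submodule.mem_bot, sub_eq_zero] at sub_exp_mem

theorem exists_isSolution (hγ : C.IsHiggsPotential r γ) :
    ∃ Γ, C.IsSolution r Γ ∧ EqOn (fun s => C.proj 1 (Γ s)) γ (polydisk n r) := by
  obtain ⟨u, hu, hu₀, hu₁, hflat⟩ := hγ.exists_flat
  obtain ⟨Γ, hΓ, huΓ⟩ := hγ.exists_exp_eq hu hu₀ hu₁ hflat
  have logForm_eq : ∀ s ∈ puncturedPolydisk n r, ∀ j,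
      logForm C.M Γ j s = higgsForm C.M γ j s := fun s hs j => by
    rw [← homDeriv_exp_eq_zero_iff, homDeriv, eulerDeriv_congr isOpen_polydisk hs.1
      (fun s hs => (huΓ s hs).symm), ← huΓ s hs.1]
    exact hflat s hs j
  have isSolution : C.IsSolution r Γ :=
    ⟨hΓ, fun s hs j => logForm_eq s hs j ▸ (hγ.higgsForm_mem hs.1 j).1⟩
  have proj_zero : C.proj 1 (Γ 0) = γ 0 := by simp [hΓ.map_zero, hγ.map_zero]
  refine ⟨Γ, isSolution, eqOn_of_eulerDeriv_eq (hΓ.differentiableOn_proj 1) hγ.differentiableOn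
    proj_zero fun s hs j => ?_⟩
  exact add_left_cancel ((isSolution.logForm_eq_higgsForm hs j).symm.trans (logForm_eq s hs j))

end IsHiggsPotential

end GradedLogConnection

/-! ### The grading of the endomorphisms by the limiting mixed Hodge structure -/

section HomGrading

variable {V : Type*} [NormedAddCommGroup V] [NormedSpace ℂ V] {U : ℤ → Submodule ℂ V}

/-- The endomorphisms of degree `b` with respect to `U`. -/
def homDegree (U : ℤ → Submodule ℂ V) (b : ℤ) : Submodule ℂ (V →L[ℂ] V) where
  carrier := {α | ∀ p, ∀ u ∈ U p, α u ∈ U (p + b)}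
  zero_mem' p _ _ := zero_mem (U (p + b))
  add_mem' hα hβ p u hu := add_mem (hα p u hu) (hβ p u hu)
  smul_mem' c _ hα p u hu := (U (p + b)).smul_mem c (hα p u hu)

theorem clm_ext_of_iSup_eq_top (htop : ⨆ p, U p = ⊤) {α β : V →L[ℂ] V}
    (h : ∀ p, ∀ u ∈ U p, α u = β u) : α = β := by
  have iSup_le_eqLocus : ⨆ p, U p ≤ LinearMap.eqLocus (α : V →ₗ[ℂ] V) β :=
    iSup_le fun p u hu => h p u hu
  exact ContinuousLinearMap.ext fun v => iSup_le_eqLocus (htop ▸ Submodule.mem_top)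

theorem isCompl_iSup_ne (hind : iSupIndep U) (htop : ⨆ p, U p = ⊤) (p : ℤ) :
    IsCompl (U p) (⨆ j, ⨆ (_ : j ≠ p), U j) :=
  ⟨hind p, codisjoint_iff.2 (by rw [← iSup_split_single, htop])⟩

variable [FiniteDimensional ℂ V] (hind : iSupIndep U) (htop : ⨆ p, U p = ⊤)

/-- The finite set of indices of the nonzero components. -/
def gradedSupport : Finset ℤ := (WellFoundedGT.finite_ne_bot_of_iSupIndep hind).toFinset

variable {hind} in
theorem mem_gradedSupport {p : ℤ} {u : V} (hu : u ∈ U p) (hu₀ : u ≠ 0) :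
    p ∈ gradedSupport hind :=
  (Set.Finite.mem_toFinset _).2 ((Submodule.ne_bot_iff _).2 ⟨u, hu, hu₀⟩)

/-- The projection of `V` to `U p`. -/
def gradedProj (p : ℤ) : V →L[ℂ] V :=
  LinearMap.toContinuousLinearMap ((U p).projection _ (isCompl_iSup_ne hind htop p))

theorem gradedProj_mem (p : ℤ) (v : V) : gradedProj hind htop p v ∈ U p :=
  Submodule.projection_apply_mem _ _

theorem gradedProj_same {p : ℤ} {v : V} (hv : v ∈ U p) : gradedProj hind htop p v = v :=
  Submodule.projection_apply_of_mem_left _ hv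

theorem gradedProj_other {p j : ℤ} (hj : j ≠ p) {v : V} (hv : v ∈ U j) :
    gradedProj hind htop p v = 0 := by
  have v_mem_ker : v ∈ ⨆ j, ⨆ (_ : j ≠ p), U j :=
    le_iSup₂_of_le (f := fun j _ => U j) j hj le_rfl hv
  rwa [← Submodule.ker_projection (isCompl_iSup_ne hind htop p)] at v_mem_ker

/-- The projection of the endomorphisms of `V` to those of degree `b`. -/
def homProj (b : ℤ) : (V →L[ℂ] V) →L[ℂ] (V →L[ℂ] V) :=
  ∑ p ∈ gradedSupport hind, ContinuousLinearMap.mulLeftRight ℂ (V →L[ℂ] V)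
    (gradedProj hind htop (p + b)) (gradedProj hind htop p)

theorem homProj_apply_apply (b : ℤ) (α : V →L[ℂ] V) {p : ℤ} {u : V} (hu : u ∈ U p) :
    homProj hind htop b α u = gradedProj hind htop (p + b) (α u) := by
  have expand : homProj hind htop b α u = ∑ q ∈ gradedSupport hind,
      gradedProj hind htop (q + b) (α (gradedProj hind htop q u)) := by simp [homProj]
  rcases eq_or_ne u 0 with rfl | hu₀
  · simp
  · rw [expand, Finset.sum_eq_single_of_mem p (mem_gradedSupport hu hu₀) fun q _ hq => by
      rw [gradedProj_other hind htop hq.symm hu, map_zero, map_zero], gradedProj_same _ _ hu]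

theorem homProj_mem (b : ℤ) (α : V →L[ℂ] V) : homProj hind htop b α ∈ homDegree U b :=
  fun p u hu => homProj_apply_apply hind htop b α hu ▸ gradedProj_mem hind htop (p + b) (α u)

theorem homProj_same {b : ℤ} {α : V →L[ℂ] V} (hα : α ∈ homDegree U b) :
    homProj hind htop b α = α :=
  clm_ext_of_iSup_eq_top htop fun p u hu => by
    rw [homProj_apply_apply hind htop b α hu, gradedProj_same _ _ (hα p u hu)]

theorem homProj_other {a b : ℤ} (hab : a ≠ b) {α : V →L[ℂ] V} (hα : α ∈ homDegree U b) :
    homProj hind htop a α = 0 :=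
  clm_ext_of_iSup_eq_top htop fun p u hu => by
    rw [homProj_apply_apply hind htop a α hu,
      gradedProj_other hind htop (by simpa using hab.symm) (hα p u hu)]
    rfl

include hind htop in
theorem exists_homDegree_neg_eq_bot : ∃ K : ℕ, ∀ k : ℕ, K ≤ k → homDegree U (-(k : ℤ)) = ⊥ := by
  set B := (gradedSupport hind).sup Int.natAbs
  refine ⟨2 * B + 1, fun k hk => (Submodule.eq_bot_iff _).2 fun α hα => ?_⟩
  refine clm_ext_of_iSup_eq_top htop fun p u hu => ?_
  by_contra hαu
  have natAbs_le {q : ℤ} {v : V} (hv : v ∈ U q) (hv₀ : v ≠ 0) : q.natAbs ≤ B :=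
    Finset.le_sup (mem_gradedSupport hv hv₀)
  have source_le : p.natAbs ≤ B := natAbs_le hu fun hu₀ => hαu (by simp [hu₀])
  have target_le : (p + -(k : ℤ)).natAbs ≤ B := natAbs_le (hα p u hu) hαu
  lia

/-- The grading of the endomorphisms of `V` of nonpositive degree, with the sign of the degree
reversed. -/
def homGrading : LowerGrading (V →L[ℂ] V) where
  E k := homDegree U (-(k : ℤ))
  proj k := homProj hind htop (-(k : ℤ))
  proj_mem k := homProj_mem hind htop (-(k : ℤ))
  proj_same _ _ hα := homProj_same hind htop hα
  proj_other _ _ hkl _ hα := homProj_other hind htop (by simpa using hkl) hα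
  mul_mem k l α hα β hβ p u hu := by
    have mul_apply_mem := hα _ _ (hβ p u hu)
    rwa [show p + -((k + l : ℕ) : ℤ) = p + -(l : ℤ) + -(k : ℤ) by lia]
  one_mem p u hu := by simpa using hu
  exists_bound := exists_homDegree_neg_eq_bot hind htop

end HomGrading

section LieAlgebra

variable {V : Type*} [NormedAddCommGroup V] [NormedSpace ℂ V] {W : ℤ → Submodule ℂ V}
  {S : ∀ k, LinearMap.BilinForm ℂ (Gr W k)} {α β : V →L[ℂ] V}

theorem grMap_lie (ha : ∀ k, ∀ v ∈ W k, α v ∈ W k) (hb : ∀ k, ∀ v ∈ W k, β v ∈ W k)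
    (hab : ∀ k, ∀ v ∈ W k, ⁅α, β⁆ v ∈ W k) (k : ℤ) (x : Gr W k) :
    grMap W ⁅α, β⁆ hab k x =
      grMap W α ha k (grMap W β hb k x) - grMap W β hb k (grMap W α ha k x) := by
  obtain ⟨x, rfl⟩ := Submodule.Quotient.mk_surjective _ x
  rfl

theorem lie_mem_lieG (hα : α ∈ lieG W S) (hβ : β ∈ lieG W S) : ⁅α, β⁆ ∈ lieG W S := by
  obtain ⟨ha, hα⟩ := hα
  obtain ⟨hb, hβ⟩ := hβ
  refine ⟨fun k v hv => sub_mem (ha k _ (hb k v hv)) (hb k _ (ha k v hv)), fun k x y => ?_⟩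
  rw [grMap_lie ha hb, grMap_lie ha hb, map_sub, map_sub, LinearMap.sub_apply]
  linear_combination hα k (grMap W β hb k x) y - hβ k (grMap W α ha k x) y +
    hα k x (grMap W β hb k y) - hβ k x (grMap W α ha k y)

end LieAlgebra

namespace LimitData

variable {V : Type*} [NormedAddCommGroup V] [NormedSpace ℂ V] [Module ℚ V] {n : ℕ}
  (D : LimitData V n)

/-- `Lie(G_ℂ)` as a Lie subalgebra of the endomorphisms of `V`. -/
def lieSubalgebra : LieSubalgebra ℂ (V →L[ℂ] V) where
  toSubmodule := D.lieAlg
  lie_mem' := lie_mem_lieG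

/-- The coefficient of `ds_j / s_j` in `Ω`. -/
def residue (j : Fin n) : V →L[ℂ] V := (1 / (2 * Real.pi * Complex.I)) • D.N j

theorem mem_wp {a : ℤ} {α : V →L[ℂ] V} : α ∈ D.wp a ↔ α ∈ homDegree D.U a ⊓ D.lieAlg := and_comm

theorem residue_mem_wp (j : Fin n) : D.residue j ∈ D.wp (-1) :=
  (D.wp (-1)).smul_mem _ ⟨D.N_mem j,
    fun p _ hu => map_hodgeU_le (D.N_rational j) (D.N_F j) (D.N_M j) p hu⟩

variable [FiniteDimensional ℂ V]

/-- The connection `d + Ω`, with the endomorphisms of `V` graded by the limiting mixed Hodge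
structure. -/
def logConnection : GradedLogConnection (V →L[ℂ] V) n where
  toLowerGrading := homGrading D.isMixedHodgeStructure.iSupIndep_hodgeU
    D.isMixedHodgeStructure.iSup_hodgeU
  g := D.lieSubalgebra
  M := D.residue
  M_mem j := D.mem_wp.1 (D.residue_mem_wp j)
  M_comm i j := have commute_N : Commute (D.N i) (D.N j) := D.N_comm i j
    (commute_N.smul_left _).smul_right _

theorem wp_neg (k : ℕ) : D.wp (-(k : ℤ)) =
    D.logConnection.E k ⊓ D.logConnection.g.toSubmodule :=
  Submodule.ext fun _ => D.mem_wp

theorem qInf_eq : D.qInf = D.logConnection.neg D.logConnection.g := by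
  refine le_antisymm (iSup₂_le fun a ha => ?_) (iSup₂_le fun k hk => ?_)
  · obtain ⟨k, rfl⟩ : ∃ k : ℕ, a = -(k : ℤ) := ⟨a.natAbs, by lia⟩
    rw [wp_neg]
    exact LowerGrading.inf_le_neg (by lia)
  · rw [← wp_neg]
    exact le_iSup₂_of_le (-(k : ℤ)) (by lia) le_rfl

theorem component_eq (k : ℕ) {α : V →L[ℂ] V} (hα : α ∈ D.qInf) :
    D.component (-(k : ℤ)) α = D.logConnection.proj k α := by
  have exists_decomposition : ∃ β : ℤ →₀ (V →L[ℂ] V),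
      (∀ b, β b ∈ D.wp b) ∧ (β.sum fun _ x => x) = α :=
    (Submodule.mem_iSup_iff_exists_finsupp _ _).1
      (iSup₂_le (fun a _ => le_iSup D.wp a) hα : α ∈ ⨆ a, D.wp a)
  obtain ⟨hβ, hsum⟩ := Classical.epsilon_spec exists_decomposition
  rw [component]
  set β := Classical.epsilon fun β : ℤ →₀ (V →L[ℂ] V) =>
    (∀ b, β b ∈ D.wp b) ∧ (β.sum fun _ x => x) = α
  have proj_other {b : ℤ} (hb : b ≠ -(k : ℤ)) : D.logConnection.proj k (β b) = 0 :=
    homProj_other _ _ hb.symm (hβ b).2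
  have proj_same : D.logConnection.proj k (β (-(k : ℤ))) = β (-(k : ℤ)) :=
    homProj_same _ _ (hβ _).2
  rw [← hsum, Finsupp.sum, map_sum,
    Finset.sum_eq_single (-(k : ℤ)) (fun b _ hb => proj_other hb) fun hk => by
      rw [Finsupp.notMem_support_iff.1 hk, map_zero], proj_same]

end LimitData

/-! ### Solutions of (6.10) -/

section Extension

variable {n : ℕ} {r : ℝ} {E : Type*} [Zero E] {s : Fin n → ℂ}

theorem ext_of_mem (f : polydisk n r → E) (hs : s ∈ polydisk n r) : ext f s = f ⟨s, hs⟩ :=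
  Subtype.val_injective.extend_apply f 0 ⟨s, hs⟩

theorem ext_of_notMem (f : polydisk n r → E) (hs : s ∉ polydisk n r) : ext f s = 0 :=
  Function.extend_apply' _ _ _ fun ⟨t, ht⟩ => hs (ht ▸ t.2)

theorem ext_comp {F : E → E} (hF : F 0 = 0) (f : polydisk n r → E) :
    ext (fun s => F (f s)) = fun s => F (ext f s) := by
  funext s
  by_cases hs : s ∈ polydisk n r
  · rw [ext_of_mem _ hs, ext_of_mem _ hs]
  · rw [ext_of_notMem _ hs, ext_of_notMem _ hs, hF]

theorem eqOn_ext_iff {f g : polydisk n r → E} :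
    Set.EqOn (ext f) (ext g) (polydisk n r) ↔ f = g := by
  refine ⟨fun h => funext fun s => ?_, fun h _ _ => by rw [h]⟩
  simpa only [ext_of_mem _ s.2] using h s.2

theorem forall_ext_mem_iff {f : polydisk n r → E} {Q : Set E} :
    (∀ s ∈ polydisk n r, ext f s ∈ Q) ↔ ∀ s, f s ∈ Q :=
  ⟨fun h s => ext_of_mem f s.2 ▸ h s s.2, fun h s hs => ext_of_mem f hs ▸ h ⟨s, hs⟩⟩

end Extension

theorem pderiv_eq_iff {n : ℕ} {E : Type*} [NormedAddCommGroup E] [NormedSpace ℂ E] {j : Fin n}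
    {f : (Fin n → ℂ) → E} {s : Fin n → ℂ} (hs : s j ≠ 0) {x : E} :
    pderiv j f s = x ↔ eulerDeriv j f s = s j • x :=
  (smul_right_inj hs).symm

namespace LimitData

section Coefficients

variable {V : Type*} [NormedAddCommGroup V] [NormedSpace ℂ V] [Module ℚ V] {n : ℕ}
  (D : LimitData V n) {r : ℝ} {s : Fin n → ℂ}

theorem smul_omega {j : Fin n} (hs : s j ≠ 0) : s j • D.omega j s = D.residue j := by
  rw [omega, residue, smul_smul]
  congr 1
  field_simp

theorem smul_higgs (g : polydisk n r → (V →L[ℂ] V)) {j : Fin n} (hs : s j ≠ 0) :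
    s j • D.higgs g j s = higgsForm D.residue (ext g) j s := by
  rw [higgs, smul_add, D.smul_omega hs]
  rfl

theorem commute_higgs_iff (g : polydisk n r → (V →L[ℂ] V)) {i j : Fin n} (hi : s i ≠ 0)
    (hj : s j ≠ 0) : D.higgs g i s * D.higgs g j s - D.higgs g j s * D.higgs g i s = 0 ↔
      Commute (higgsForm D.residue (ext g) i s) (higgsForm D.residue (ext g) j s) := by
  rw [← D.smul_higgs g hi, ← D.smul_higgs g hj, Commute.smul_left_iff₀ hi,
    Commute.smul_right_iff₀ hj, sub_eq_zero]
  rfl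

theorem smul_form [CompleteSpace V] (G : (Fin n → ℂ) → (V →L[ℂ] V)) {j : Fin n} (hs : s j ≠ 0) :
    s j • D.form G j s = logForm D.residue G j s := by
  have expNegAd_eq : expNegAd (G s) (D.omega j s) = exp (-(G s)) * D.omega j s * exp (G s) :=
    exp_neg_adjointOp_apply (G s) (D.omega j s)
  rw [form, expNegAd_eq, smul_add, logForm, mul_add, ← D.smul_omega hs, eulerDeriv, add_comm,
    mul_smul_comm, smul_mul_assoc, mul_smul_comm, mul_assoc]

theorem form_mem_iff [CompleteSpace V] (G : (Fin n → ℂ) → (V →L[ℂ] V)) {j : Fin n}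
    (hs : s j ≠ 0) (Q : Submodule ℂ (V →L[ℂ] V)) :
    D.form G j s ∈ Q ↔ logForm D.residue G j s ∈ Q := by
  rw [← D.smul_form G hs, Submodule.smul_mem_iff _ hs]

end Coefficients

variable {V : Type*} [NormedAddCommGroup V] [NormedSpace ℂ V] [Module ℚ V] [FiniteDimensional ℂ V]
  {n : ℕ} {D : LimitData V n} {r : ℝ} {s : Fin n → ℂ} {Γ g : polydisk n r → (V →L[ℂ] V)}

theorem isHiggsMap_iff : D.IsHiggsMap g ↔ D.logConnection.IsHiggsPotential r (ext g) := by
  have mem_iff : (∀ s, g s ∈ D.wp (-1)) ↔ ∀ s ∈ polydisk n r,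
      ext g s ∈ D.logConnection.E 1 ⊓ D.logConnection.g.toSubmodule := by
    rw [← D.wp_neg 1]
    exact forall_ext_mem_iff.symm
  constructor
  · rintro ⟨holomorphic, mem, map_zero, commute⟩
    exact ⟨holomorphic, map_zero, mem_iff.1 mem,
      fun s hs i j => (D.commute_higgs_iff g (hs.2 i) (hs.2 j)).1 (commute s hs i j)⟩
  · rintro ⟨holomorphic, map_zero, mem, commute⟩
    exact ⟨holomorphic, mem_iff.2 mem, map_zero,
      fun s hs i j => (D.commute_higgs_iff g (hs.2 i) (hs.2 j)).2 (commute s hs i j)⟩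

theorem isSolution_iff : D.IsSolution Γ ↔ D.logConnection.IsSolution r (ext Γ) := by
  have mem_iff : (∀ s, Γ s ∈ D.qInf) ↔ ∀ s ∈ polydisk n r,
      ext Γ s ∈ D.logConnection.neg D.logConnection.g := by
    rw [← D.qInf_eq]
    exact forall_ext_mem_iff.symm
  constructor
  · rintro ⟨holomorphic, mem, map_zero, form_mem⟩
    refine ⟨⟨holomorphic, map_zero, mem_iff.1 mem⟩, fun s hs j => ?_⟩
    exact (D.wp_neg 1 ▸ (D.form_mem_iff _ (hs.2 j) _).1 (form_mem s hs j)).1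
  · intro hΓ
    refine ⟨hΓ.differentiableOn, mem_iff.2 hΓ.mem_neg, hΓ.map_zero, fun s hs j => ?_⟩
    refine (D.form_mem_iff _ (hs.2 j) _).2 ?_
    have mem_E := hΓ.logForm_mem s hs j
    have mem := LowerGrading.proj_mem_of_mem_neg (hΓ.logForm_mem_neg hs.1 j) 1
    rw [D.logConnection.proj_same 1 _ mem_E, ← D.wp_neg 1] at mem
    exact mem

theorem ext_componentMap (hΓ : ∀ s, Γ s ∈ D.qInf) (k : ℕ) :
    ext (D.componentMap (-(k : ℤ)) Γ) = fun s => D.logConnection.proj k (ext Γ s) := by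
  rw [← ext_comp (map_zero _)]
  exact congrArg ext (funext fun s => D.component_eq k (hΓ s))

theorem ext_truncation (hΓ : ∀ s, Γ s ∈ D.qInf) (k : ℕ) :
    ext (D.truncation k Γ) = fun s => D.logConnection.trunc k (ext Γ s) := by
  rw [← ext_comp (map_zero _)]
  refine congrArg ext (funext fun s => ?_)
  rw [LowerGrading.trunc_apply]
  exact Finset.sum_congr rfl fun i _ => D.component_eq i (hΓ s)

namespace IsSolution

theorem isHiggsMap (hΓ : D.IsSolution Γ) : D.IsHiggsMap (D.componentMap (-1) Γ) :=
  isHiggsMap_iff.2 (ext_componentMap hΓ.2.1 1 ▸ (isSolution_iff.1 hΓ).isHiggsPotential)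

theorem smul_component_form_truncation (hΓ : D.IsSolution Γ) (k : ℕ)
    (hs : s ∈ puncturedPolydisk n r) (j : Fin n) :
    s j • D.component (-(k : ℤ)) (D.form (ext (D.truncation k Γ)) j s) =
      D.logConnection.proj k
        (logForm D.residue (fun s => D.logConnection.trunc k (ext Γ s)) j s) := by
  have isGauge_trunc := (isSolution_iff.1 hΓ).toIsGauge.trunc k
  have form_mem : D.form (ext (D.truncation k Γ)) j s ∈ D.qInf := by
    rw [D.form_mem_iff _ (hs.2 j), ext_truncation hΓ.2.1, qInf_eq]
    exact isGauge_trunc.logForm_mem_neg hs.1 j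
  rw [D.component_eq k form_mem, ← map_smul, D.smul_form _ (hs.2 j), ext_truncation hΓ.2.1]

theorem pderiv_componentMap (hΓ : D.IsSolution Γ) {k : ℕ} (hk : 2 ≤ k)
    (hs : s ∈ puncturedPolydisk n r) (j : Fin n) :
    pderiv j (ext (D.componentMap (-(k : ℤ)) Γ)) s =
      -D.component (-(k : ℤ)) (D.form (ext (D.truncation k Γ)) j s) := by
  rw [pderiv_eq_iff (hs.2 j), smul_neg, hΓ.smul_component_form_truncation k hs,
    ext_componentMap hΓ.2.1]
  exact (isSolution_iff.1 hΓ).eulerDeriv_proj_of_two_le hk hs j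

theorem eq_componentMap_iff (hΓ : D.IsSolution Γ) {k : ℕ} (hk : 2 ≤ k)
    (h : polydisk n r → (V →L[ℂ] V)) : h = D.componentMap (-(k : ℤ)) Γ ↔
      IsHolomorphic h ∧ (∀ s, h s ∈ D.wp (-(k : ℤ))) ∧ ext h 0 = 0 ∧
      ∀ s ∈ puncturedPolydisk n r, ∀ j, pderiv j (ext h) s =
        -D.component (-(k : ℤ)) (D.form (ext (D.truncation k Γ)) j s) := by
  have hC := isSolution_iff.1 hΓ
  have holomorphic : IsHolomorphic (D.componentMap (-(k : ℤ)) Γ) := by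
    rw [IsHolomorphic, ext_componentMap hΓ.2.1]
    exact hC.differentiableOn_proj k
  have map_zero : ext (D.componentMap (-(k : ℤ)) Γ) 0 = 0 := by
    simp only [ext_componentMap hΓ.2.1, hC.map_zero, _root_.map_zero]
  constructor
  · rintro rfl
    refine ⟨holomorphic, fun s => ?_, map_zero, fun s hs j => hΓ.pderiv_componentMap hk hs j⟩
    rw [componentMap, D.component_eq k (hΓ.2.1 s), wp_neg]
    exact LowerGrading.proj_mem_of_mem_neg (D.qInf_eq ▸ hΓ.2.1 s) k
  · rintro ⟨h_holomorphic, -, h_zero, h_pderiv⟩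
    refine eqOn_ext_iff.1 (eqOn_of_eulerDeriv_eq h_holomorphic holomorphic
      (h_zero.trans map_zero.symm) fun s hs j => ?_)
    exact congrArg (s j • ·) ((h_pderiv s hs j).trans (hΓ.pderiv_componentMap hk hs j).symm)

end IsSolution

variable (D) in
theorem injOn_componentMap : Set.InjOn (D.componentMap (-1))
    {Γ : polydisk n r → (V →L[ℂ] V) | D.IsSolution Γ} := by
  intro Γ hΓ Γ' hΓ' heq
  refine eqOn_ext_iff.1
    ((isSolution_iff.1 hΓ).eqOn_of_eqOn_proj_one (isSolution_iff.1 hΓ') fun s _ => ?_)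
  have ext_eq : ext (D.componentMap (-1) Γ) = ext (D.componentMap (-1) Γ') := congrArg ext heq
  exact congrFun (ext_componentMap hΓ.2.1 1 ▸ ext_componentMap hΓ'.2.1 1 ▸ ext_eq) s

namespace IsHiggsMap

theorem exists_isSolution (hr : 0 < r) (hg : D.IsHiggsMap g) :
    ∃ Γ, D.IsSolution Γ ∧ D.componentMap (-1) Γ = g := by
  obtain ⟨Γ, hΓ, proj_eq⟩ := (isHiggsMap_iff.1 hg).exists_isSolution
  have ext_eq : Set.EqOn (ext fun s : polydisk n r => Γ s) Γ (polydisk n r) :=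
    fun _ hs => ext_of_mem _ hs
  have isSolution : D.IsSolution fun s : polydisk n r => Γ s :=
    isSolution_iff.2 (hΓ.congr hr ext_eq)
  refine ⟨_, isSolution, eqOn_ext_iff.1 fun s hs => ?_⟩
  exact (congrFun (ext_componentMap isSolution.2.1 1) s).trans
    ((congrArg _ (ext_eq hs)).trans (proj_eq hs))

end IsHiggsMap

end LimitData

/-! ### Flatness and monodromy -/

section ParallelTransport

open Set

theorem hasDerivAt_neg_mul_of_mul_eq_one {A : Type*} [NormedRing A] [NormedAlgebra ℝ A]
    {Φ Ψ H : ℝ → A} (hΨ : ∀ t, HasDerivAt Ψ (Ψ t * H t) t) (hΦ : Differentiable ℝ Φ)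
    (hΨΦ : ∀ t, Ψ t * Φ t = 1) (hΦΨ : ∀ t, Φ t * Ψ t = 1) (t : ℝ) :
    HasDerivAt Φ (-(H t * Φ t)) t := by
  have deriv_mul_eq_zero : Ψ t * H t * Φ t + Ψ t * deriv Φ t = 0 :=
    ((hΨ t).fun_mul (hΦ t).hasDerivAt).unique
      (by simpa only [hΨΦ] using hasDerivAt_const t (1 : A))
  refine (hΦ t).hasDerivAt.congr_deriv (eq_neg_of_add_eq_zero_right ?_)
  calc H t * Φ t + deriv Φ t = Φ t * Ψ t * (H t * Φ t + deriv Φ t) := by rw [hΦΨ, one_mul]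
    _ = Φ t * (Ψ t * H t * Φ t + Ψ t * deriv Φ t) := by simp only [mul_assoc, mul_add]
    _ = 0 := by rw [deriv_mul_eq_zero, mul_zero]

variable {V : Type*} [NormedAddCommGroup V] [NormedSpace ℂ V] {Φ Ψ H : ℝ → (V →L[ℂ] V)}

theorem apply_eq_of_hasDerivWithinAt {σ : ℝ → V} (hΨ : ∀ t, HasDerivAt Ψ (Ψ t * H t) t)
    (hσ : ∀ t ∈ Icc (0 : ℝ) 1, HasDerivWithinAt σ (-(H t (σ t))) (Icc 0 1) t) :
    Ψ 1 (σ 1) = Ψ 0 (σ 0) := by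
  have hasDeriv_zero (t : ℝ) (ht : t ∈ Icc (0 : ℝ) 1) :
      HasDerivWithinAt (fun t => Ψ t (σ t)) 0 (Icc 0 1) t := by
    have hasDerivAt_restrictScalars :=
      (ContinuousLinearMap.restrictScalarsL ℂ V V ℝ ℝ).hasFDerivAt.comp_hasDerivAt t (hΨ t)
    refine (hasDerivAt_restrictScalars.hasDerivWithinAt.clm_apply (hσ t ht)).congr_deriv ?_
    simp
  exact constant_of_derivWithin_zero (fun t ht => (hasDeriv_zero t ht).differentiableWithinAt)
    (fun t ht => (hasDeriv_zero t (Ico_subset_Icc_self ht)).derivWithin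
      (uniqueDiffOn_Icc_zero_one t (Ico_subset_Icc_self ht))) 1 (right_mem_Icc.2 zero_le_one)

/-- Here `Φ` is the fundamental solution of `σ' + H σ = 0` and `Ψ` its inverse. -/
theorem parallelTransport_iff {T : V →L[ℂ] V} (hΨ : ∀ t, HasDerivAt Ψ (Ψ t * H t) t)
    (hΦ : Differentiable ℝ Φ) (hΨΦ : ∀ t, Ψ t * Φ t = 1) (hΦΨ : ∀ t, Φ t * Ψ t = 1)
    (hΦ₀ : Φ 0 = 1) :
    (∀ v : V, ∃ σ : ℝ → V, σ 0 = v ∧ σ 1 = T v ∧ ∀ t ∈ Icc (0 : ℝ) 1,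
      HasDerivWithinAt σ (-(H t (σ t))) (Icc 0 1) t) ↔ T = Φ 1 := by
  constructor
  · refine fun h => ContinuousLinearMap.ext fun v => ?_
    obtain ⟨σ, hσ₀, hσ₁, hσ⟩ := h v
    have hΨ₀ : Ψ 0 = 1 := by simpa only [hΦ₀, mul_one] using hΨΦ 0
    have apply_eq : Ψ 1 (T v) = v := by
      rw [← hσ₁, apply_eq_of_hasDerivWithinAt hΨ hσ, hΨ₀, hσ₀, one_apply_eq_self]
    calc T v = (Φ 1 * Ψ 1) (T v) := by rw [hΦΨ, one_apply_eq_self]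
      _ = Φ 1 v := congrArg (Φ 1) apply_eq
  · rintro rfl v
    refine ⟨fun t => Φ t v, by simp only [hΦ₀, one_apply_eq_self], rfl, fun t _ => ?_⟩
    exact (((ContinuousLinearMap.apply ℂ V v).restrictScalars ℝ).hasFDerivAt.comp_hasDerivAt t
      (hasDerivAt_neg_mul_of_mul_eq_one hΨ hΦ hΨΦ hΦΨ t)).hasDerivWithinAt

end ParallelTransport

namespace LimitData

section Flatness

variable {V : Type*} [NormedAddCommGroup V] [NormedSpace ℂ V] [Module ℚ V] {n : ℕ}
  {D : LimitData V n} {r : ℝ} {s : Fin n → ℂ} {g : polydisk n r → (V →L[ℂ] V)}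

theorem differentiableAt_omega {j : Fin n} (hs : s j ≠ 0) :
    DifferentiableAt ℂ (D.omega j) s := by
  unfold omega
  fun_prop (disch := exact hs)

theorem pderiv_omega {i j : Fin n} (hij : i ≠ j) (hs : s j ≠ 0) : pderiv i (D.omega j) s = 0 := by
  rw [pderiv, ← (differentiableAt_omega hs).lineDeriv_eq_fderiv, lineDeriv]
  simp [omega, hij.symm]

variable [FiniteDimensional ℂ V]

theorem pderiv_higgs (hg : IsHolomorphic g) {i j : Fin n} (hij : i ≠ j)
    (hs : s ∈ puncturedPolydisk n r) :
    pderiv i (D.higgs g j) s = pderiv i (pderiv j (ext g)) s := by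
  have differentiableAt_pderiv : DifferentiableAt ℂ (pderiv j (ext g)) s :=
    differentiableAt_of_mem_polydisk
      (differentiableOn_fderiv_apply isOpen_polydisk hg (Pi.single j 1)) hs.1
  have fderiv_higgs : fderiv ℂ (D.higgs g j) s =
      fderiv ℂ (D.omega j) s + fderiv ℂ (pderiv j (ext g)) s :=
    fderiv_fun_add (differentiableAt_omega (hs.2 j)) differentiableAt_pderiv
  rw [pderiv, fderiv_higgs, add_apply]
  exact add_eq_right.2 (pderiv_omega hij (hs.2 j))

theorem IsHiggsMap.isFlat (hg : D.IsHiggsMap g) : D.IsFlat g := by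
  intro s hs i j
  rw [hg.2.2.2 s hs i j, add_zero, sub_eq_zero]
  rcases eq_or_ne i j with rfl | hij
  · rfl
  rw [pderiv_higgs hg.1 hij hs, pderiv_higgs hg.1 hij.symm hs]
  exact fderiv_fderiv_comm isOpen_polydisk hg.1 hs.1 _ _

end Flatness

section Loop

variable {n : ℕ} {r : ℝ} {s : Fin n → ℂ}

theorem loop_mem (hs : s ∈ puncturedPolydisk n r) (j : Fin n) (t : ℝ) :
    loop j s t ∈ puncturedPolydisk n r := by
  have norm_exp : ‖Complex.exp (2 * Real.pi * Complex.I * t)‖ = 1 := by simp [Complex.norm_exp]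
  refine ⟨fun i => ?_, fun i => ?_⟩ <;> rcases eq_or_ne i j with rfl | hij
  · simpa [loop, norm_exp] using hs.1 i
  · simpa [loop, hij] using hs.1 i
  · simpa [loop] using hs.2 i
  · simpa [loop, hij] using hs.2 i

theorem loop_zero (j : Fin n) (s : Fin n → ℂ) : loop j s 0 = s := by
  simp [loop]

theorem loop_one (j : Fin n) (s : Fin n → ℂ) : loop j s 1 = s := by
  simp [loop]

theorem hasDerivAt_loop (j : Fin n) (s : Fin n → ℂ) (t : ℝ) :
    HasDerivAt (loop j s) ((2 * Real.pi * Complex.I * loop j s t j) • Pi.single j (1 : ℂ)) t := by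
  have hasDerivAt_exponent : HasDerivAt (fun t : ℂ => 2 * Real.pi * Complex.I * t)
      (2 * Real.pi * Complex.I) t := by
    simpa using (hasDerivAt_id (t : ℂ)).const_mul (2 * Real.pi * Complex.I : ℂ)
  refine hasDerivAt_pi.2 fun i => ?_
  rcases eq_or_ne i j with rfl | hij
  · simpa [loop, mul_comm, mul_left_comm] using
      (hasDerivAt_exponent.cexp.mul_const (s i)).comp_ofReal
  · simpa [loop, hij] using hasDerivAt_const t (s i)

theorem hasDerivAt_comp_loop {E : Type*} [NormedAddCommGroup E] [NormedSpace ℂ E]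
    {f : (Fin n → ℂ) → E} (hf : DifferentiableOn ℂ f (polydisk n r))
    (hs : s ∈ puncturedPolydisk n r) (j : Fin n) (t : ℝ) :
    HasDerivAt (fun t => f (loop j s t))
      ((2 * Real.pi * Complex.I : ℂ) • eulerDeriv j f (loop j s t)) t := by
  have differentiableAt_f := differentiableAt_of_mem_polydisk hf (loop_mem hs j t).1
  refine ((differentiableAt_f.hasFDerivAt.restrictScalars ℝ).comp_hasDerivAt t
    (hasDerivAt_loop j s t)).congr_deriv ?_
  rw [ContinuousLinearMap.coe_restrictScalars', map_smul, eulerDeriv, smul_smul]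
  rfl

end Loop

variable {V : Type*} [NormedAddCommGroup V] [NormedSpace ℂ V] [Module ℚ V] {n : ℕ}
  {D : LimitData V n} {r : ℝ} {s : Fin n → ℂ} {Γ : polydisk n r → (V →L[ℂ] V)}

theorem two_pi_I_smul_residue (j : Fin n) :
    (2 * Real.pi * Complex.I : ℂ) • D.residue j = D.N j := by
  rw [residue, smul_smul, mul_one_div_cancel Complex.two_pi_I_ne_zero, one_smul]

variable [FiniteDimensional ℂ V]

namespace IsSolution

theorem hasDerivAt_exp_loop (hΓ : D.IsSolution Γ) (hs : s ∈ puncturedPolydisk n r) (j : Fin n)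
    (t : ℝ) : HasDerivAt (fun t => exp (ext Γ (loop j s t)))
      (exp (ext Γ (loop j s t)) * ((2 * Real.pi * Complex.I * loop j s t j) •
        D.higgs (D.componentMap (-1) Γ) j (loop j s t)) - D.N j * exp (ext Γ (loop j s t))) t := by
  have homDeriv_eq_zero := (isSolution_iff.1 hΓ).homDeriv_exp (loop_mem hs j t) j
  rw [homDeriv, sub_eq_zero, ← eq_sub_iff_add_eq] at homDeriv_eq_zero
  have smul_higgs : (2 * Real.pi * Complex.I * loop j s t j) •
      D.higgs (D.componentMap (-1) Γ) j (loop j s t) = (2 * Real.pi * Complex.I : ℂ) •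
        higgsForm D.residue (fun s => D.logConnection.proj 1 (ext Γ s)) j (loop j s t) := by
    rw [← ext_componentMap hΓ.2.1 1, ← D.smul_higgs _ ((loop_mem hs j t).2 j), smul_smul]
    rfl
  refine (hasDerivAt_comp_loop (differentiableOn_exp hΓ.1) hs j t).congr_deriv ?_
  rw [homDeriv_eq_zero, smul_higgs, smul_sub, ← two_pi_I_smul_residue, mul_smul_comm,
    smul_mul_assoc]
  rfl

theorem isMonodromy_iff (hΓ : D.IsSolution Γ) (hs : s ∈ puncturedPolydisk n r) (j : Fin n)
    (T : V →L[ℂ] V) : D.IsMonodromy (D.componentMap (-1) Γ) j s T ↔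
      T = exp (-(ext Γ s)) * exp (-(D.N j)) * exp (ext Γ s) := by
  set P : ℝ → (V →L[ℂ] V) := fun t => exp (ext Γ (loop j s t))
  set Q : ℝ → (V →L[ℂ] V) := fun t => exp (-(ext Γ (loop j s t)))
  have hQ : Differentiable ℝ Q := fun t =>
    (hasDerivAt_comp_loop (differentiableOn_exp hΓ.1.neg) hs j t).differentiableAt
  have hQP (t : ℝ) : Q t * P t = 1 := exp_neg_mul_exp _
  have hPQ (t : ℝ) : P t * Q t = 1 := exp_mul_exp_neg _
  have hasDerivAt_inverse (t : ℝ) := ((hasDerivAt_exp_smul_const (D.N j) t).fun_mul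
    (hΓ.hasDerivAt_exp_loop hs j t)).const_mul (Q 0)
  have differentiable_fundamental :
      Differentiable ℝ fun t => Q t * exp (t • -(D.N j)) * P 0 := fun t =>
    (((hQ t).fun_mul (hasDerivAt_exp_smul_const (-(D.N j)) t).differentiableAt).mul_const (P 0))
  have inverse_mul_fundamental (t : ℝ) :
      Q 0 * (exp (t • D.N j) * P t) * (Q t * exp (t • -(D.N j)) * P 0) = 1 := by
    calc _ = Q 0 * (exp (t • D.N j) * (P t * Q t) * exp (t • -(D.N j))) * P 0 := by noncomm_ring
      _ = 1 := by rw [hPQ, mul_one, smul_neg, exp_mul_exp_neg, mul_one, hQP]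
  have fundamental_mul_inverse (t : ℝ) :
      Q t * exp (t • -(D.N j)) * P 0 * (Q 0 * (exp (t • D.N j) * P t)) = 1 := by
    calc _ = Q t * (exp (t • -(D.N j)) * (P 0 * Q 0) * exp (t • D.N j)) * P t := by noncomm_ring
      _ = 1 := by rw [hPQ, mul_one, smul_neg, exp_neg_mul_exp, mul_one, hQP]
  have fundamental_zero : Q 0 * exp ((0 : ℝ) • -(D.N j)) * P 0 = 1 := by
    rw [zero_smul, NormedSpace.exp_zero, mul_one, hQP]
  have isMonodromy_iff_eq := parallelTransport_iff (T := T)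
    (H := fun t => (2 * Real.pi * Complex.I * loop j s t j) •
      D.higgs (D.componentMap (-1) Γ) j (loop j s t))
    (fun t => (hasDerivAt_inverse t).congr_deriv (by noncomm_ring)) differentiable_fundamental
    inverse_mul_fundamental fundamental_mul_inverse fundamental_zero
  simpa only [IsMonodromy, Q, P, loop_zero, loop_one, one_smul, smul_apply] using isMonodromy_iff_eq

end IsSolution

end LimitData

end

end LimitHodge

theorem theorem6p16 {V : Type*} [NormedAddCommGroup V] [NormedSpace ℂ V] [Module ℚ V]
    [FiniteDimensional ℂ V] {n : ℕ} (D : LimitHodge.LimitData V n) {r : ℝ} (hr : 0 < r) :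
    -- the correspondence `Γ ↦ Γ_{-1}` is a bijection
    Set.BijOn (D.componentMap (-1))
      {Γ : LimitHodge.polydisk n r → (V →L[ℂ] V) | D.IsSolution Γ}
      {g : LimitHodge.polydisk n r → (V →L[ℂ] V) | D.IsHiggsMap g} ∧
    ∀ Γ : LimitHodge.polydisk n r → (V →L[ℂ] V), D.IsSolution Γ →
      -- the inductive determination of the higher components
      (∀ k : ℕ, 2 ≤ k → ∀ h : LimitHodge.polydisk n r → (V →L[ℂ] V),
        h = D.componentMap (-(k : ℤ)) Γ ↔
          LimitHodge.IsHolomorphic h ∧ (∀ s, h s ∈ D.wp (-(k : ℤ))) ∧ LimitHodge.ext h 0 = 0 ∧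
          ∀ s ∈ LimitHodge.puncturedPolydisk n r, ∀ j,
            LimitHodge.pderiv j (LimitHodge.ext h) s =
              -D.component (-(k : ℤ)) (D.form (LimitHodge.ext (D.truncation k Γ)) j s)) ∧
      -- the connection `d + ∂X_{-1}` is flat, with monodromy `e^{-Γ} e^{-N_j} e^{Γ}`
      D.IsFlat (D.componentMap (-1) Γ) ∧
      ∀ s ∈ LimitHodge.puncturedPolydisk n r, ∀ j, ∀ T : V →L[ℂ] V,
        D.IsMonodromy (D.componentMap (-1) Γ) j s T ↔
          T = NormedSpace.exp (-(LimitHodge.ext Γ s)) * NormedSpace.exp (-(D.N j)) *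
            NormedSpace.exp (LimitHodge.ext Γ s) := by
  refine ⟨⟨fun Γ hΓ => hΓ.isHiggsMap, D.injOn_componentMap, fun g hg => hg.exists_isSolution hr⟩,
    fun Γ hΓ => ⟨fun k hk h => hΓ.eq_componentMap_iff hk h, hΓ.isHiggsMap.isFlat,
      fun s hs j T => hΓ.isMonodromy_iff hs j T⟩⟩
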